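/- Consider a finite Markov decision process with non-empty finite state space $\mathcal S$, finite action space $\mathcal A$, transition matrices $(P_a)_{a\in\mathcal A}$, reward function $\mathcal R:\mathcal S\times\mathcal A\to[0,1]$ and discount factor $\gamma\in(0,1)$, and let $\pi$ be a policy. Let $P_\pi(s,s')=\sum_a\pi(a|s)P_a(s,s')$ and let $V_\pi(s)=\mathbb E_\pi\big[\sum_{k\ge0}\gamma^k\mathcal R(S_k,A_k)\mid S_0=s\big]$ be the value function of $\pi$. Assume that the Markov chain $\mathcal M_S=\{S_k\}$ induced by $\pi$ (with transition matrix $P_\pi$) is irreducible and aperiodic; then it has a unique stationary distribution $\kappa$. Put $\mathcal K_{\min}=\min_s\kappa(s)$ and, for $\delta>0$, $t_\delta=t_\delta(\mathcal M_S)=\min\{k\ge0:\max_s\|P_\pi^k(s,\cdot)-\kappa\|_{\mathrm{TV}}\le\delta\}$, where $\|p-q\|_{\mathrm{TV}}=\tfrac12\sum_s|p(s)-q(s)|$. Let $\{(S_k,A_k)\}_{k\ge0}$ be a trajectory generated by $\pi$, with arbitrary law of $S_0$, let $\lambda\in(0,1)$, and let $\{V_k\}$ be the iterates of TD($\lambda$)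 with eligibility traces, deterministic $V_0\in\mathbb R^{\mathcal S}$ and constant stepsize $\alpha>0$: $$V_{k+1}(s)=V_k(s)+\alpha\, z_k(s)\big(\mathcal R(S_k,A_k)+\gamma V_k(S_{k+1})-V_k(S_k)\big),\qquad z_k(s)=\sum_{i=0}^k(\gamma\lambda)^{k-i}\mathbf 1_{\{S_i=s\}}.$$ Let $$\tau=\min\{k\ge0:(\gamma\lambda)^{k+1}\le\alpha\},\qquad \beta_4=1-\mathcal K_{\min}\frac{(1-\gamma)\big(1-(\gamma\lambda)^{\tau+1}\big)}{1-\gamma\lambda}.$$ There is a numerical constant $\tilde c_0>0$ (independent of all of the above data) such that, whenever $\alpha(t_\alpha+2\tau+1)\le\tilde c_0(1-\beta_4)(1-\gamma\lambda)^2$, one has for all $k\ge t_\alpha+2\tau+1$ $$\mathbb E\big[\|V_k-V_\pi\|_2^2\big]\le\tilde c_1\big(1-(1-\beta_4)\alpha\big)^{k-(t_\alpha+2\tau+1)}+\tilde c_2\,\frac{\alpha\,(t_\alpha+\tau+1)}{(1-\gamma\lambda)^2(1-\beta_4)},$$ where $\tilde c_1=(\|V_0-V_\pi\|_2+\|V_0\|_2+1)^2$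 and $\tilde c_2=114\,(4\|V_\pi\|_2+1)^2$. -/

import Mathlib

open MeasureTheory ProbabilityTheory

universe u v w

/-- A finite discounted Markov decision process with rewards in `[0, 1]`: `P s a` is the law of the
next state after action `a` in state `s`, `reward` the reward function, `γ` the discount factor. -/
structure DiscountedMDP (𝒮 𝒜 : Type*) where
  P : 𝒮 → 𝒜 → PMF 𝒮
  reward : 𝒮 → 𝒜 → ℝ
  γ : ℝ
  reward_mem : ∀ s a, reward s a ∈ Set.Icc (0 : ℝ) 1
  γ_pos : 0 < γ
  γ_lt_one : γ < 1

/-- A (stationary, randomized) policy: `π s` is the law of the action taken in state `s`. -/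
abbrev Policy (𝒮 𝒜 : Type*) := 𝒮 → PMF 𝒜

/-- The law of `(S, A)` when `S` has law `q` and, given `S`, the action `A` has law `π S`. -/
noncomputable def stateActionPMF {𝒮 𝒜 : Type*} (π : Policy 𝒮 𝒜) (q : PMF 𝒮) : PMF (𝒮 × 𝒜) :=
  q.bind fun s => (π s).map fun a => (s, a)

namespace DiscountedMDP

section Law

variable {𝒮 𝒜 : Type*} [Fintype 𝒮] [MeasurableSpace 𝒮] [DiscreteMeasurableSpace 𝒮]
  [Fintype 𝒜] [MeasurableSpace 𝒜] [DiscreteMeasurableSpace 𝒜]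

/-- The Markov kernel giving the law of `(S_{k+1}, A_{k+1})` given `(S_k, A_k) = (s, a)`:
`S_{k+1}` has law `P s a` and `A_{k+1}` has law `π S_{k+1}`. -/
noncomputable def oneStepKernel (M : DiscountedMDP 𝒮 𝒜) (π : Policy 𝒮 𝒜) :
    Kernel (𝒮 × 𝒜) (𝒮 × 𝒜) where
  toFun y := (stateActionPMF π (M.P y.1 y.2)).toMeasure
  measurable' := measurable_of_countable _

instance (M : DiscountedMDP 𝒮 𝒜) (π : Policy 𝒮 𝒜) : IsMarkovKernel (M.oneStepKernel π) :=
  ⟨fun y => inferInstanceAs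
    (IsProbabilityMeasure (stateActionPMF π (M.P y.1 y.2)).toMeasure)⟩

/-- The law of `(S_{n+1}, A_{n+1})` given the whole history up to time `n`; it depends on the
history only through the last state-action pair. -/
noncomputable def historyKernel (M : DiscountedMDP 𝒮 𝒜) (π : Policy 𝒮 𝒜) (n : ℕ) :
    Kernel ((_ : Finset.Iic n) → 𝒮 × 𝒜) (𝒮 × 𝒜) :=
  (M.oneStepKernel π).comap (fun h => h ⟨n, Finset.mem_Iic.2 le_rfl⟩) (measurable_pi_apply _)

instance (M : DiscountedMDP 𝒮 𝒜) (π : Policy 𝒮 𝒜) (n : ℕ) :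
    IsMarkovKernel (M.historyKernel π n) :=
  inferInstanceAs (IsMarkovKernel ((M.oneStepKernel π).comap _ _))

/-- The law on `(𝒮 × 𝒜)^ℕ` of the trajectory `(S_k, A_k)_{k ≥ 0}` generated by the policy `π` when
`S_0` has law `ρ`. -/
noncomputable def trajectoryLaw (M : DiscountedMDP 𝒮 𝒜) (π : Policy 𝒮 𝒜) (ρ : PMF 𝒮) :
    Measure (ℕ → 𝒮 × 𝒜) :=
  Kernel.trajMeasure (X := fun _ => 𝒮 × 𝒜) (stateActionPMF π ρ).toMeasure (M.historyKernel π)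

/-- The value function `V_π(s) = 𝔼_π [∑_k γ ^ k * reward (S_k, A_k) | S_0 = s]`. -/
noncomputable def valueFunction (M : DiscountedMDP 𝒮 𝒜) (π : Policy 𝒮 𝒜) : EuclideanSpace ℝ 𝒮 :=
  WithLp.toLp 2 fun s =>
    ∫ x, ∑' k : ℕ, M.γ ^ k * M.reward (x k).1 (x k).2 ∂(M.trajectoryLaw π (PMF.pure s))

end Law

/-- The transition matrix `P_π(s, s') = ∑_a π(a|s) P_a(s, s')` of the state chain `{S_k}`
induced by `π`. -/
noncomputable def transitionMatrix {𝒮 𝒜 : Type*} [Fintype 𝒜] (M : DiscountedMDP 𝒮 𝒜)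
    (π : Policy 𝒮 𝒜) : Matrix 𝒮 𝒮 ℝ :=
  Matrix.of fun s s' => ∑ a, (π s a).toReal * (M.P s a s').toReal

end DiscountedMDP

section MarkovChain

variable {𝒮 : Type*} [Fintype 𝒮]

/-- `κ` is a stationary distribution of the transition matrix `P`. -/
structure IsStationaryDistribution (P : Matrix 𝒮 𝒮 ℝ) (κ : 𝒮 → ℝ) : Prop where
  nonneg : ∀ s, 0 ≤ κ s
  sum_eq_one : ∑ s, κ s = 1
  stationary : Matrix.vecMul κ P = κ

/-- Aperiodicity: for every state `s`, the return times `{k ≥ 1 : P ^ k (s, s) > 0}` have greatest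
common divisor `1`. -/
def IsAperiodicChain [DecidableEq 𝒮] (P : Matrix 𝒮 𝒮 ℝ) : Prop :=
  ∀ s, ∀ d : ℕ, (∀ k : ℕ, 1 ≤ k → 0 < (P ^ k) s s → d ∣ k) → d = 1

/-- Total variation distance of two probability vectors. -/
noncomputable def tvDistance (p q : 𝒮 → ℝ) : ℝ := (1 / 2) * ∑ s, |p s - q s|

/-- The mixing time with precision `δ`:
`min {k ≥ 0 : max_s ‖P ^ k (s, ·) - κ‖_TV ≤ δ}`. -/
noncomputable def mixingTime [DecidableEq 𝒮] (P : Matrix 𝒮 𝒮 ℝ) (κ : 𝒮 → ℝ) (δ : ℝ) : ℕ :=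
  sInf {k : ℕ | ∀ s, tvDistance ((P ^ k) s) κ ≤ δ}

end MarkovChain

section TDLambda

/-- The truncation level `τ = min {k ≥ 0 : (γ λ) ^ (k + 1) ≤ α}`. -/
noncomputable def truncationLevel (γ lam α : ℝ) : ℕ :=
  sInf {k : ℕ | (γ * lam) ^ (k + 1) ≤ α}

/-- The contraction factor
`β = 1 - K_min (1 - γ) (1 - (γ λ) ^ (τ + 1)) / (1 - γ λ)`, where `K_min = min_s κ(s)`. -/
noncomputable def tdContraction {𝒮 : Type*} (κ : 𝒮 → ℝ) (γ lam : ℝ) (τ : ℕ) : ℝ :=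
  1 - (⨅ s, κ s) * ((1 - γ) * (1 - (γ * lam) ^ (τ + 1)) / (1 - γ * lam))

variable {𝒮 𝒜 : Type*} [DecidableEq 𝒮]

/-- The eligibility trace `z_k(s) = ∑_{i=0}^k (γ λ)^(k-i) 1{S_i = s}` along the trajectory
`x = (S_k, A_k)_k`. -/
noncomputable def eligibilityTrace (γ lam : ℝ) (x : ℕ → 𝒮 × 𝒜) (k : ℕ) (s : 𝒮) : ℝ :=
  ∑ i ∈ Finset.range (k + 1), (γ * lam) ^ (k - i) * (if (x i).1 = s then 1 else 0)

/-- The temporal difference `reward(s, a) + γ V(s') - V(s)`. -/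
noncomputable def temporalDifference (M : DiscountedMDP 𝒮 𝒜) (V : EuclideanSpace ℝ 𝒮)
    (s : 𝒮) (a : 𝒜) (s' : 𝒮) : ℝ :=
  M.reward s a + M.γ * V s' - V s

/-- The TD(λ) iterates `V_k`, with initial value `V₀` and stepsizes `α k`, along the trajectory
`x = (S_k, A_k)_k`:
`V_{k+1}(s) = V_k(s) + α_k z_k(s) (reward(S_k, A_k) + γ V_k(S_{k+1}) - V_k(S_k))`. -/
noncomputable def tdLambda (M : DiscountedMDP 𝒮 𝒜) (lam : ℝ) (α : ℕ → ℝ)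
    (V₀ : EuclideanSpace ℝ 𝒮) (x : ℕ → 𝒮 × 𝒜) : ℕ → EuclideanSpace ℝ 𝒮
  | 0 => V₀
  | k + 1 => WithLp.toLp 2 fun s =>
      tdLambda M lam α V₀ x k s + α k * eligibilityTrace M.γ lam x k s *
        temporalDifference M (tdLambda M lam α V₀ x k) (x k).1 (x k).2 (x (k + 1)).1

end TDLambda

/-! Write `y_k = V_k - V_π`, let `d_k` be the temporal difference and `h = 1 - γλ`. Expanding
`‖y_{k+1}‖²` leaves the cross term `2α d_k ⟨y_k, z_k⟩`, in which the iterate, the trace and the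
current transition are correlated. The correlation is broken by a delay: `V_k` is replaced by `V_m`
with `m = k - (t + τ + 1)`, and the trace by its last `τ + 1` terms. The iterate moves by `O(ε)(1 +
‖V_m‖)` during the delay, with `ε = α(t + τ + 1)/h` (`norm_tdLambda_sub_le`), and the trace tail is
at most `α/h`, so the replacement costs `O(αε/h)(1 + ‖V_m‖)²` (`norm_sq_add_smul_le'`).

In the delayed cross term, the lag `i ≤ τ` pairs `y_m(S_{k-i})` with the temporal difference at time
`k`. By the Markov property and the Bellman equation, averaging after time `k - i` turns the latter
into `P^i(γP - 1) y_m`. The state `S_{k-i}` lies at least `t` steps after `S_{m+1}`, so given the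
history up to time `m` its law is `α`-close to `κ` (`integral_drift_le`). Under `κ` itself the drift
is governed by `a_j = ⟨x, P^j x⟩_κ`: stationarity gives `a_j ≤ a_0`, and summation by parts together
with `a_0 ≥ K_min ‖x‖²` yields at most `-(1 - β)‖x‖²` (`IsStationaryDistribution.td_drift_le`).

For small stepsizes half of this negative drift pays for the errors and half gives the rate
(`drift_recursion`). The resulting affine recursion is iterated from time `t + 2τ + 1`, before which
the iterate has hardly moved. Existence and uniqueness of `κ`, and finiteness of the mixing time,
come from Doeblin's contraction. -/

/-! ### Finite Markov chains: positivity of powers, stationary distribution, mixing. -/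

section FiniteMarkovChain

open Matrix

variable {n : Type*} [Fintype n]

lemma sum_abs_vecMul_le (x : n → ℝ) {B : Matrix n n ℝ} (hB : ∀ i j, 0 ≤ B i j) {c : ℝ}
    (hc : ∀ i, ∑ j, B i j = c) : ∑ j, |(x ᵥ* B) j| ≤ c * ∑ i, |x i| := by
  calc ∑ j, |(x ᵥ* B) j| ≤ ∑ j, ∑ i, |x i| * B i j := by
        refine Finset.sum_le_sum fun j _ => ?_
        simp only [vecMul, dotProduct]
        refine (Finset.abs_sum_le_sum_abs _ _).trans (Finset.sum_le_sum fun i _ => ?_)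
        rw [abs_mul, abs_of_nonneg (hB i j)]
    _ = c * ∑ i, |x i| := by
        rw [Finset.sum_comm, Finset.mul_sum]
        refine Finset.sum_congr rfl fun i _ => ?_
        rw [← Finset.mul_sum, hc, mul_comm]

lemma sum_vecMul_eq (x : n → ℝ) {B : Matrix n n ℝ} {c : ℝ}
    (hc : ∀ i, ∑ j, B i j = c) : ∑ j, (x ᵥ* B) j = c * ∑ i, x i := by
  simp only [vecMul, dotProduct]
  rw [Finset.sum_comm, Finset.mul_sum]
  refine Finset.sum_congr rfl fun i _ => ?_
  rw [← Finset.mul_sum, hc, mul_comm]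

/-- Doeblin's contraction: a stochastic matrix with positive entries strictly contracts the
`ℓ¹`-norm on vectors with zero sum. -/
lemma exists_contraction_of_pos [DecidableEq n] [Nonempty n] {Q : Matrix n n ℝ}
    (hQ : Q ∈ rowStochastic ℝ n) (hpos : ∀ i j, 0 < Q i j) :
    ∃ c : ℝ, 0 ≤ c ∧ c < 1 ∧ ∀ x : n → ℝ, ∑ i, x i = 0 →
      ∑ j, |(x ᵥ* Q) j| ≤ c * ∑ i, |x i| := by
  obtain ⟨p, hp⟩ := Finite.exists_min fun p : n × n => Q p.1 p.2
  set ε := Q p.1 p.2 with hε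
  have hεpos : 0 < ε := hpos _ _
  have hnn : ∀ i j, 0 ≤ (Q - of fun _ _ => ε : Matrix n n ℝ) i j := fun i j => by
    simpa using hp (i, j)
  have hsum : ∀ i, ∑ j, (Q - of fun _ _ => ε : Matrix n n ℝ) i j =
      1 - Fintype.card n * ε := fun i => by
    simp [sum_row_of_mem_rowStochastic hQ i]
  refine ⟨1 - Fintype.card n * ε, ?_, ?_, fun x hx => ?_⟩
  · rw [← hsum (Classical.arbitrary n)]
    exact Finset.sum_nonneg fun j _ => hnn _ j
  · have : 0 < (Fintype.card n : ℝ) := by exact_mod_cast Fintype.card_pos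
    nlinarith [mul_pos this hεpos]
  -- The constant matrix `ε` kills vectors of zero sum, so `Q` may be replaced by the nonnegative
  -- remainder, whose rows all sum to `c`.
  · have h : x ᵥ* Q = x ᵥ* (Q - of fun _ _ => ε : Matrix n n ℝ) := by
      have : x ᵥ* (of fun _ _ => ε : Matrix n n ℝ) = 0 := by
        ext j
        simp [vecMul, dotProduct, ← Finset.sum_mul, hx]
      rw [vecMul_sub, this, sub_zero]
    rw [h]
    exact sum_abs_vecMul_le x hnn hsum

lemma pow_add_apply_pos [DecidableEq n] {P : Matrix n n ℝ} (hP : ∀ i j, 0 ≤ P i j) {a b : ℕ}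
    {i j l : n} (h₁ : 0 < (P ^ a) i j) (h₂ : 0 < (P ^ b) j l) : 0 < (P ^ (a + b)) i l := by
  rw [pow_add, mul_apply]
  exact Finset.sum_pos' (fun m _ => mul_nonneg (pow_apply_nonneg hP a i m)
    (pow_apply_nonneg hP b m l)) ⟨j, Finset.mem_univ j, mul_pos h₁ h₂⟩

/-- The return times of an aperiodic state contain all large enough integers. -/
lemma eventually_return_pos [DecidableEq n] {P : Matrix n n ℝ} (hP : ∀ i j, 0 ≤ P i j)
    (hap : IsAperiodicChain P) (s : n) : ∃ N, ∀ m ≥ N, 0 < (P ^ m) s s := by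
  let T : AddSubmonoid ℕ :=
    { carrier := {k | 0 < (P ^ k) s s}
      zero_mem' := by simp
      add_mem' := fun ha hb => pow_add_apply_pos hP ha hb }
  have hgcd : Nat.setGcd (T : Set ℕ) = 1 :=
    hap s _ fun k _ hk => Nat.setGcd_dvd_of_mem (show k ∈ (T : Set ℕ) from hk)
  -- A submonoid of `ℕ` contains every sufficiently large multiple of its gcd.
  obtain ⟨N, hN⟩ := Nat.exists_mem_closure_of_ge (T : Set ℕ)
  refine ⟨N, fun m hm => ?_⟩
  have := hN m hm (by rw [hgcd]; exact one_dvd m)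
  rw [AddSubmonoid.closure_eq] at this
  exact this

lemma exists_pow_pos_of_aperiodic [DecidableEq n] {P : Matrix n n ℝ} (hirr : P.IsIrreducible)
    (hap : IsAperiodicChain P) : ∃ m, ∀ i j, 0 < (P ^ m) i j := by
  have hP := hirr.nonneg
  choose N hN using eventually_return_pos hP hap
  choose K _ hK using (isIrreducible_iff_exists_pow_pos hP).1 hirr
  -- Any exponent exceeding every `N i + K i j` works: loop at `i` for the spare time, then travel
  -- to `j` in `K i j` steps. The sums serve as crude maxima.
  refine ⟨∑ i, N i + ∑ p : n × n, K p.1 p.2, fun i j => ?_⟩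
  have h₁ : N i ≤ ∑ i, N i :=
    Finset.single_le_sum (f := N) (fun _ _ => Nat.zero_le _) (Finset.mem_univ i)
  have h₂ : K i j ≤ ∑ p : n × n, K p.1 p.2 :=
    Finset.single_le_sum (f := fun p : n × n => K p.1 p.2) (fun _ _ => Nat.zero_le _)
      (Finset.mem_univ (i, j))
  have := pow_add_apply_pos hP
    (hN i (∑ i, N i + ∑ p : n × n, K p.1 p.2 - K i j) (by omega)) (hK i j)
  rwa [Nat.sub_add_cancel (by omega)] at this

/-- Since `P 1 = 1`, the matrix `P - 1` is singular and has a left null vector `v`. Then `|v| ≤ |v|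
P` entrywise, and both sides have the same total mass, so equality holds and `|v|` can be
normalized. -/
lemma exists_isStationaryDistribution [DecidableEq n] [Nonempty n] {P : Matrix n n ℝ}
    (hP : P ∈ rowStochastic ℝ n) : ∃ κ, IsStationaryDistribution P κ := by
  have hdet : (P - 1).det = 0 := by
    refine exists_mulVec_eq_zero_iff.1 ⟨1, one_ne_zero, ?_⟩
    rw [sub_mulVec, hP.2, one_mulVec, sub_self]
  obtain ⟨v, hv0, hv⟩ := exists_vecMul_eq_zero_iff.2 hdet
  rw [vecMul_sub, vecMul_one, sub_eq_zero] at hv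
  have hle : ∀ j, |v j| ≤ ((fun i => |v i|) ᵥ* P) j := fun j => by
    conv_lhs => rw [← hv]
    simp only [vecMul, dotProduct]
    refine (Finset.abs_sum_le_sum_abs _ _).trans (Finset.sum_le_sum fun i _ => ?_)
    rw [abs_mul, abs_of_nonneg (hP.1 i j)]
  have hsum : ∑ j, |v j| = ∑ j, ((fun i => |v i|) ᵥ* P) j := by
    rw [sum_vecMul_eq _ (sum_row_of_mem_rowStochastic hP), one_mul]
  have heq := (Finset.sum_eq_sum_iff_of_le fun j _ => hle j).1 hsum
  have hpos : 0 < ∑ j, |v j| := by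
    obtain ⟨i, hi⟩ := Function.ne_iff.1 hv0
    exact Finset.sum_pos' (fun _ _ => abs_nonneg _) ⟨i, Finset.mem_univ i, abs_pos.2 hi⟩
  refine ⟨(∑ j, |v j|)⁻¹ • fun i => |v i|, fun s => ?_, ?_, ?_⟩
  · exact mul_nonneg (inv_nonneg.2 hpos.le) (abs_nonneg _)
  · simp only [Pi.smul_apply, smul_eq_mul, ← Finset.mul_sum]
    exact inv_mul_cancel₀ hpos.ne'
  · rw [smul_vecMul]
    congr 1
    ext j
    exact (heq j (Finset.mem_univ j)).symm

lemma IsStationaryDistribution.vecMul_pow [DecidableEq n] {P : Matrix n n ℝ} {κ : n → ℝ}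
    (h : IsStationaryDistribution P κ) (k : ℕ) : κ ᵥ* P ^ k = κ := by
  induction k with
  | zero => simp
  | succ k ih => rw [pow_succ, ← vecMul_vecMul, ih, h.stationary]

lemma IsStationaryDistribution.eq_of_pow_pos [DecidableEq n] [Nonempty n] {P : Matrix n n ℝ}
    (hP : P ∈ rowStochastic ℝ n) {m : ℕ} (hm : ∀ i j, 0 < (P ^ m) i j) {κ κ' : n → ℝ}
    (h : IsStationaryDistribution P κ) (h' : IsStationaryDistribution P κ') : κ' = κ := by
  obtain ⟨c, -, hc1, hc⟩ := exists_contraction_of_pos (pow_mem hP m) hm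
  have := hc (κ' - κ) (by simp [h.sum_eq_one, h'.sum_eq_one])
  rw [sub_vecMul, h.vecMul_pow, h'.vecMul_pow] at this
  have hz : ∑ i, |(κ' - κ) i| = 0 := by
    have : 0 ≤ ∑ i, |(κ' - κ) i| := Finset.sum_nonneg fun _ _ => abs_nonneg _
    nlinarith
  ext i
  have := (Finset.sum_eq_zero_iff_of_nonneg fun _ _ => abs_nonneg _).1 hz i (Finset.mem_univ i)
  simpa [sub_eq_zero] using this

lemma exists_tvDistance_pow_le [DecidableEq n] [Nonempty n] {P : Matrix n n ℝ}
    (hP : P ∈ rowStochastic ℝ n) {m : ℕ} (hm : ∀ i j, 0 < (P ^ m) i j) {κ : n → ℝ}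
    (h : IsStationaryDistribution P κ) {δ : ℝ} (hδ : 0 < δ) :
    ∃ k, ∀ s, tvDistance ((P ^ k) s) κ ≤ δ := by
  obtain ⟨c, hc0, hc1, hc⟩ := exists_contraction_of_pos (pow_mem hP m) hm
  have hrow := sum_row_of_mem_rowStochastic (pow_mem hP m)
  have hiter : ∀ (j : ℕ) (x : n → ℝ), ∑ i, x i = 0 →
      ∑ i, |(x ᵥ* (P ^ m) ^ j) i| ≤ c ^ j * ∑ i, |x i| := by
    intro j
    induction j with
    | zero => intro x _; simp
    | succ j ih =>
      intro x hx
      rw [pow_succ', ← vecMul_vecMul]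
      refine (ih _ ?_).trans ?_
      · rw [sum_vecMul_eq x hrow, hx, mul_zero]
      · rw [pow_succ, mul_assoc]
        exact mul_le_mul_of_nonneg_left (hc x hx) (pow_nonneg hc0 j)
  -- `c ^ j < δ` is enough: the `ℓ¹` distance of a point mass to `κ` is at most `2`, which cancels
  -- the `1 / 2` in the total variation.
  obtain ⟨j, hj⟩ := exists_pow_lt_of_lt_one hδ hc1
  refine ⟨m * j, fun s => ?_⟩
  have hx : ∑ i, (Pi.single s 1 - κ : n → ℝ) i = 0 := by
    simp [h.sum_eq_one]
  have hx2 : ∑ i, |(Pi.single s 1 - κ : n → ℝ) i| ≤ 2 := by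
    calc ∑ i, |(Pi.single s 1 - κ : n → ℝ) i|
        ≤ ∑ i, ((Pi.single s 1 : n → ℝ) i + κ i) := by
          refine Finset.sum_le_sum fun i _ => ?_
          have h0 : 0 ≤ (Pi.single s 1 : n → ℝ) i := by
            by_cases hi : i = s
            · subst hi; simp
            · simp [hi]
          exact abs_le.2 ⟨by simp only [Pi.sub_apply]; linarith,
            by simp only [Pi.sub_apply]; linarith [h.nonneg i]⟩
      _ = 2 := by rw [Finset.sum_add_distrib, h.sum_eq_one]; simp; norm_num
  have key := hiter j _ hx
  have hfun : (Pi.single s 1 - κ) ᵥ* (P ^ m) ^ j = (P ^ (m * j)) s - κ := by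
    rw [← pow_mul, sub_vecMul, h.vecMul_pow, single_one_vecMul]
    rfl
  rw [hfun] at key
  have hcj := pow_nonneg hc0 j
  simp only [Pi.sub_apply] at key hx2
  unfold tvDistance
  nlinarith

/-- `mixingTime` is an `sInf` over `ℕ`, equal to `0` on the empty set; the bound holds because
convergence makes the set nonempty. -/
lemma tvDistance_mixingTime_le [DecidableEq n] [Nonempty n] {P : Matrix n n ℝ}
    (hP : P ∈ rowStochastic ℝ n) (hirr : P.IsIrreducible) (hap : IsAperiodicChain P) {κ : n → ℝ}
    (h : IsStationaryDistribution P κ) {δ : ℝ} (hδ : 0 < δ) (s : n) :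
    tvDistance ((P ^ mixingTime P κ δ) s) κ ≤ δ := by
  obtain ⟨m, hm⟩ := exists_pow_pos_of_aperiodic hirr hap
  exact Nat.sInf_mem (exists_tvDistance_pow_le hP hm h hδ) s

lemma existsUnique_isStationaryDistribution [DecidableEq n] [Nonempty n] {P : Matrix n n ℝ}
    (hP : P ∈ rowStochastic ℝ n) (hirr : P.IsIrreducible) (hap : IsAperiodicChain P) :
    ∃! κ, IsStationaryDistribution P κ := by
  obtain ⟨m, hm⟩ := exists_pow_pos_of_aperiodic hirr hap
  obtain ⟨κ, hκ⟩ := exists_isStationaryDistribution hP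
  exact ⟨κ, hκ, fun κ' hκ' => hκ.eq_of_pow_pos hP hm hκ'⟩

/-- If every row of `R` is `δ`-close to `κ`, so is every mixture of rows. -/
lemma sum_abs_vecMul_sub_le {R : Matrix n n ℝ} {κ q : n → ℝ} {δ : ℝ}
    (hq0 : ∀ i, 0 ≤ q i) (hq1 : ∑ i, q i = 1) (h : ∀ i, tvDistance (R i) κ ≤ δ) :
    ∑ s, |(q ᵥ* R) s - κ s| ≤ 2 * δ := by
  have hsplit : ∀ s, (q ᵥ* R) s - κ s = ∑ i, q i * (R i s - κ s) := fun s => by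
    simp only [mul_sub, Finset.sum_sub_distrib, ← Finset.sum_mul, hq1, one_mul]
    rfl
  calc ∑ s, |(q ᵥ* R) s - κ s| ≤ ∑ s, ∑ i, q i * |R i s - κ s| := by
        refine Finset.sum_le_sum fun s _ => ?_
        rw [hsplit]
        refine (Finset.abs_sum_le_sum_abs _ _).trans (Finset.sum_le_sum fun i _ => ?_)
        rw [abs_mul, abs_of_nonneg (hq0 i)]
    _ = ∑ i, q i * ∑ s, |R i s - κ s| := by
        rw [Finset.sum_comm]
        exact Finset.sum_congr rfl fun i _ => (Finset.mul_sum _ _ _).symm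
    _ ≤ ∑ i, q i * (2 * δ) := by
        refine Finset.sum_le_sum fun i _ => mul_le_mul_of_nonneg_left ?_ (hq0 i)
        have := h i
        unfold tvDistance at this
        linarith
    _ = 2 * δ := by rw [← Finset.sum_mul, hq1, one_mul]

end FiniteMarkovChain

/-! ### The stationary drift of truncated TD(λ). -/

section Drift

open Matrix

variable {n : Type*} [Fintype n] [DecidableEq n]

/-- The action of a stochastic matrix on `L²(κ)`, for a stationary `κ`, has norm at most one. -/
lemma IsStationaryDistribution.sum_mul_pow_mulVec_le {P : Matrix n n ℝ}
    (hP : P ∈ rowStochastic ℝ n) {κ : n → ℝ} (h : IsStationaryDistribution P κ) (x : n → ℝ)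
    (j : ℕ) : ∑ s, κ s * (x s * (P ^ j *ᵥ x) s) ≤ ∑ s, κ s * x s ^ 2 := by
  have hPj := pow_mem hP j
  -- `x_s x_u ≤ (x_s² + x_u²) / 2`, averaged over `u`; stationarity then gives both squares the same
  -- `κ`-mean.
  have h1 : ∀ s, x s * (P ^ j *ᵥ x) s ≤ x s ^ 2 / 2 + (P ^ j *ᵥ fun u => x u ^ 2 / 2) s := by
    intro s
    have : x s ^ 2 / 2 = ∑ u, (P ^ j) s u * (x s ^ 2 / 2) := by
      rw [← Finset.sum_mul, sum_row_of_mem_rowStochastic hPj, one_mul]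
    rw [this]
    simp only [mulVec, dotProduct, Finset.mul_sum, ← Finset.sum_add_distrib]
    refine Finset.sum_le_sum fun u _ => ?_
    nlinarith [mul_nonneg (hPj.1 s u) (sq_nonneg (x s - x u))]
  calc ∑ s, κ s * (x s * (P ^ j *ᵥ x) s)
      ≤ ∑ s, κ s * (x s ^ 2 / 2 + (P ^ j *ᵥ fun u => x u ^ 2 / 2) s) :=
        Finset.sum_le_sum fun s _ => mul_le_mul_of_nonneg_left (h1 s) (h.nonneg s)
    _ = ∑ s, κ s * (x s ^ 2 / 2) + κ ⬝ᵥ (P ^ j *ᵥ fun u => x u ^ 2 / 2) := by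
        simp only [mul_add, Finset.sum_add_distrib, dotProduct]
    _ = ∑ s, κ s * x s ^ 2 := by
        rw [dotProduct_mulVec, h.vecMul_pow, dotProduct, ← Finset.sum_add_distrib]
        exact Finset.sum_congr rfl fun s _ => by ring

/-- Summation by parts for the truncated `λ`-weighted temporal differences. -/
lemma sum_pow_mul_sub_le {a : ℕ → ℝ} {c γ : ℝ} (hc : 0 ≤ c) (hcγ : c ≤ γ) (hc1 : c < 1)
    (ha : ∀ j, a j ≤ a 0) (τ : ℕ) :
    ∑ i ∈ Finset.range (τ + 1), c ^ i * (γ * a (i + 1) - a i) ≤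
      -((1 - γ) * (1 - c ^ (τ + 1)) / (1 - c)) * a 0 := by
  -- After regrouping, each intermediate `a j` has coefficient `c ^ (j - 1) * (γ - c) ≥ 0`, so it
  -- may be replaced by `a 0`; the last term is kept apart for the induction.
  have key : ∀ τ : ℕ, ∑ i ∈ Finset.range (τ + 1), c ^ i * (γ * a (i + 1) - a i) ≤
      γ * c ^ τ * a (τ + 1) + (-1 + (γ - c) * ∑ i ∈ Finset.range τ, c ^ i) * a 0 := by
    intro τ
    induction τ with
    | zero => simp
    | succ τ ih =>
      rw [Finset.sum_range_succ, Finset.sum_range_succ (fun i => c ^ i) τ]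
      have h1 : c ^ τ * (γ - c) * a (τ + 1) ≤ c ^ τ * (γ - c) * a 0 :=
        mul_le_mul_of_nonneg_left (ha _) (mul_nonneg (pow_nonneg hc τ) (sub_nonneg.2 hcγ))
      rw [pow_succ]
      linarith
  refine (key τ).trans ?_
  have h2 : γ * c ^ τ * a (τ + 1) ≤ γ * c ^ τ * a 0 :=
    mul_le_mul_of_nonneg_left (ha _) (mul_nonneg (hc.trans hcγ) (pow_nonneg hc τ))
  have h3 : ∑ i ∈ Finset.range τ, c ^ i = (1 - c ^ τ) / (1 - c) := by
    rw [geom_sum_eq hc1.ne, ← neg_div_neg_eq]; ring_nf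
  have hne : 1 - c ≠ 0 := by linarith
  have h4 : γ * c ^ τ + (-1 + (γ - c) * ((1 - c ^ τ) / (1 - c))) =
      -((1 - γ) * (1 - c ^ (τ + 1)) / (1 - c)) := by
    field_simp
    ring
  rw [h3, ← h4, add_mul]
  linarith

/-- The mean-field drift of truncated TD(λ) is a contraction in the Euclidean norm. -/
lemma IsStationaryDistribution.td_drift_le [Nonempty n] {P : Matrix n n ℝ}
    (hP : P ∈ rowStochastic ℝ n) {κ : n → ℝ} (h : IsStationaryDistribution P κ) {γ lam : ℝ}
    (hγ0 : 0 < γ) (hγ1 : γ < 1) (hl0 : 0 < lam) (hl1 : lam < 1) (x : n → ℝ) (τ : ℕ) :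
    ∑ i ∈ Finset.range (τ + 1), (γ * lam) ^ i *
      ∑ s, κ s * (x s * (P ^ i *ᵥ (γ • (P *ᵥ x) - x)) s) ≤
      -(1 - tdContraction κ γ lam τ) * ∑ s, x s ^ 2 := by
  have hc : 0 ≤ γ * lam := by positivity
  have hcγ : γ * lam ≤ γ := by nlinarith
  have hc1 : γ * lam < 1 := by linarith
  set a : ℕ → ℝ := fun j => ∑ s, κ s * (x s * (P ^ j *ᵥ x) s) with ha
  have ha0 : a 0 = ∑ s, κ s * x s ^ 2 := by
    simp only [ha, pow_zero, one_mulVec]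
    exact Finset.sum_congr rfl fun s _ => by ring
  have hterm : ∀ i, ∑ s, κ s * (x s * (P ^ i *ᵥ (γ • (P *ᵥ x) - x)) s) =
      γ * a (i + 1) - a i := by
    intro i
    simp only [ha, Finset.mul_sum, ← Finset.sum_sub_distrib]
    refine Finset.sum_congr rfl fun s _ => ?_
    rw [mulVec_sub, mulVec_smul, mulVec_mulVec, ← pow_succ]
    simp only [Pi.sub_apply, Pi.smul_apply, smul_eq_mul]
    ring
  simp only [hterm]
  refine (sum_pow_mul_sub_le hc hcγ hc1 (fun j => ?_) τ).trans ?_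
  · rw [ha0]; exact h.sum_mul_pow_mulVec_le hP x j
  have hθ : 0 ≤ (1 - γ) * (1 - (γ * lam) ^ (τ + 1)) / (1 - γ * lam) :=
    div_nonneg (mul_nonneg (by linarith) (sub_nonneg.2 (pow_le_one₀ hc hc1.le))) (by linarith)
  have hK : (⨅ s, κ s) * ∑ s, x s ^ 2 ≤ a 0 := by
    rw [ha0, Finset.mul_sum]
    exact Finset.sum_le_sum fun s _ => mul_le_mul_of_nonneg_right
      (ciInf_le (Set.finite_range κ).bddBelow s) (sq_nonneg _)
  unfold tdContraction
  nlinarith [mul_le_mul_of_nonneg_left hK hθ]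

-- `K_min ≤ 1`, and `1 - γ ≤ 1 - γλ` bounds the other factor.
omit [DecidableEq n] in
lemma IsStationaryDistribution.one_sub_tdContraction_le_one [Nonempty n] {P : Matrix n n ℝ}
    {κ : n → ℝ} (h : IsStationaryDistribution P κ) {γ lam : ℝ}
    (hγ0 : 0 < γ) (hγ1 : γ < 1) (hl0 : 0 < lam) (hl1 : lam < 1) (τ : ℕ) :
    1 - tdContraction κ γ lam τ ≤ 1 := by
  have hc : 0 ≤ γ * lam := by positivity
  have hcγ : γ * lam ≤ γ := by nlinarith
  have hpow := pow_nonneg hc (τ + 1)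
  have hpow1 : (γ * lam) ^ (τ + 1) ≤ 1 := pow_le_one₀ hc (by linarith)
  have hθ1 : (1 - γ) * (1 - (γ * lam) ^ (τ + 1)) / (1 - γ * lam) ≤ 1 := by
    rw [div_le_one (by linarith)]
    nlinarith [mul_nonneg (sub_nonneg.2 hγ1.le) hpow]
  have hθ0 : 0 ≤ (1 - γ) * (1 - (γ * lam) ^ (τ + 1)) / (1 - γ * lam) :=
    div_nonneg (mul_nonneg (by linarith) (by linarith)) (by linarith)
  have hK0 : 0 ≤ ⨅ s, κ s := Real.iInf_nonneg h.nonneg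
  have hK1 : ⨅ s, κ s ≤ 1 := by
    let s := Classical.arbitrary n
    refine (ciInf_le (Set.finite_range κ).bddBelow s).trans ?_
    rw [← h.sum_eq_one]
    exact Finset.single_le_sum (fun i _ => h.nonneg i) (Finset.mem_univ s)
  unfold tdContraction
  nlinarith

end Drift

/-! ### Functions of finitely many coordinates of a trajectory. -/

section FiniteDependence

variable {Y : Type*} [Finite Y] [MeasurableSpace Y] [DiscreteMeasurableSpace Y]

omit [Finite Y] [MeasurableSpace Y] [DiscreteMeasurableSpace Y] in
lemma DependsOn.exists_comp_frestrictLe {β : Type*} [Nonempty β] {f : (ℕ → Y) → β} {n : ℕ}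
    (hf : DependsOn f (Set.Iic n)) :
    ∃ g : ((_ : Finset.Iic n) → Y) → β, f = g ∘ Preorder.frestrictLe n := by
  rw [← Finset.coe_Iic] at hf
  exact dependsOn_iff_exists_comp.1 hf

lemma DependsOn.measurable_of_finite {f : (ℕ → Y) → ℝ} {n : ℕ}
    (hf : DependsOn f (Set.Iic n)) : Measurable f := by
  obtain ⟨g, rfl⟩ := hf.exists_comp_frestrictLe
  exact (measurable_of_countable g).comp (Preorder.measurable_frestrictLe n)

lemma DependsOn.integrable_of_finite {f : (ℕ → Y) → ℝ} {n : ℕ}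
    (hf : DependsOn f (Set.Iic n)) (μ : Measure (ℕ → Y)) [IsFiniteMeasure μ] :
    Integrable f μ := by
  have hm := hf.measurable_of_finite
  obtain ⟨g, rfl⟩ := hf.exists_comp_frestrictLe
  obtain ⟨C, hC⟩ := (Set.finite_range fun h => ‖g h‖).bddAbove
  exact Integrable.of_bound hm.aestronglyMeasurable C
    (Filter.Eventually.of_forall fun x => hC ⟨_, rfl⟩)

end FiniteDependence

/-! ### The Markov property of the trajectory and the Bellman equation. -/

lemma PMF.sum_toReal_eq_one {α : Type*} [Fintype α] (p : PMF α) : ∑ a, (p a).toReal = 1 := by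
  have h := p.tsum_coe
  rw [tsum_fintype] at h
  rw [← ENNReal.toReal_sum fun a _ => p.apply_ne_top a, h, ENNReal.toReal_one]

lemma stateActionPMF_apply {𝒮 𝒜 : Type*} (π : Policy 𝒮 𝒜) (q : PMF 𝒮) (s : 𝒮) (a : 𝒜) :
    stateActionPMF π q (s, a) = q s * π s a := by
  classical
  rw [stateActionPMF, PMF.bind_apply, tsum_eq_single s]
  · rw [PMF.map_apply, tsum_eq_single a]
    · simp
    · intro a' ha'
      simp [ha'.symm]
  · intro s' hs'
    rw [PMF.map_apply]
    simp [hs'.symm]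

namespace DiscountedMDP

section TransitionMatrix

variable {𝒮 𝒜 : Type*} [Fintype 𝒮] [Fintype 𝒜] (M : DiscountedMDP 𝒮 𝒜) (π : Policy 𝒮 𝒜)

lemma transitionMatrix_mulVec (f : 𝒮 → ℝ) (s : 𝒮) :
    (M.transitionMatrix π).mulVec f s =
      ∑ a, (π s a).toReal * ∑ s', (M.P s a s').toReal * f s' := by
  simp only [transitionMatrix, Matrix.mulVec, dotProduct, Matrix.of_apply, Finset.sum_mul,
    Finset.mul_sum]
  rw [Finset.sum_comm]
  simp only [mul_assoc]

lemma transitionMatrix_mem_rowStochastic [DecidableEq 𝒮] :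
    M.transitionMatrix π ∈ Matrix.rowStochastic ℝ 𝒮 := by
  rw [Matrix.mem_rowStochastic_iff_sum]
  refine ⟨fun i j => Finset.sum_nonneg fun a _ =>
    mul_nonneg ENNReal.toReal_nonneg ENNReal.toReal_nonneg, fun i => ?_⟩
  simp only [transitionMatrix, Matrix.of_apply]
  rw [Finset.sum_comm]
  simp only [← Finset.mul_sum, PMF.sum_toReal_eq_one, mul_one]

end TransitionMatrix

section Expectations

variable {𝒮 𝒜 : Type*} [Fintype 𝒮] [MeasurableSpace 𝒮] [DiscreteMeasurableSpace 𝒮]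
  [Fintype 𝒜] [MeasurableSpace 𝒜] [DiscreteMeasurableSpace 𝒜]
  (M : DiscountedMDP 𝒮 𝒜) (π : Policy 𝒮 𝒜)

lemma integral_stateActionPMF (q : PMF 𝒮) (f : 𝒮 × 𝒜 → ℝ) :
    ∫ y, f y ∂(stateActionPMF π q).toMeasure =
      ∑ s, (q s).toReal * ∑ a, (π s a).toReal * f (s, a) := by
  rw [PMF.integral_eq_sum, Fintype.sum_prod_type]
  refine Finset.sum_congr rfl fun s _ => ?_
  rw [Finset.mul_sum]
  refine Finset.sum_congr rfl fun a _ => ?_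
  rw [stateActionPMF_apply, ENNReal.toReal_mul, smul_eq_mul, mul_assoc]

instance (ρ : PMF 𝒮) : IsProbabilityMeasure (M.trajectoryLaw π ρ) := by
  unfold trajectoryLaw; infer_instance

/-- The Markov property of the trajectory, in integrated form. -/
lemma integral_succ (ρ : PMF 𝒮) {n : ℕ} {F : (ℕ → 𝒮 × 𝒜) → 𝒮 × 𝒜 → ℝ}
    (hF : DependsOn F (Set.Iic n)) :
    ∫ x, F x (x (n + 1)) ∂(M.trajectoryLaw π ρ) =
      ∫ x, ∑ s, (M.P (x n).1 (x n).2 s).toReal * ∑ a, (π s a).toReal * F x (s, a)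
        ∂(M.trajectoryLaw π ρ) := by
  -- Through `G` everything lives on a finite space of histories, where measurability and
  -- integrability are automatic.
  obtain ⟨G, rfl⟩ := hF.exists_comp_frestrictLe
  have hmap := Kernel.map_frestrictLe_trajMeasure_compProd_eq_map_trajMeasure
    (X := fun _ => 𝒮 × 𝒜) (μ₀ := (stateActionPMF π ρ).toMeasure) (κ := M.historyKernel π) (a := n)
  have hmeas : Measurable fun x : ℕ → 𝒮 × 𝒜 =>
      (Preorder.frestrictLe (π := fun _ => 𝒮 × 𝒜) n x, x (n + 1)) := by
    fun_prop
  have hG : Measurable (Function.uncurry G) := measurable_of_countable _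
  calc ∫ x, G (Preorder.frestrictLe n x) (x (n + 1)) ∂(M.trajectoryLaw π ρ)
      = ∫ z, Function.uncurry G z ∂((M.trajectoryLaw π ρ).map fun x =>
          (Preorder.frestrictLe (π := fun _ => 𝒮 × 𝒜) n x, x (n + 1))) := by
        rw [integral_map hmeas.aemeasurable hG.aestronglyMeasurable]
        rfl
    _ = ∫ h, ∫ y, G h y ∂(M.historyKernel π n h)
          ∂((M.trajectoryLaw π ρ).map (Preorder.frestrictLe n)) := by
        unfold trajectoryLaw
        have : IsProbabilityMeasure ((Kernel.trajMeasure (X := fun _ => 𝒮 × 𝒜)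
            (stateActionPMF π ρ).toMeasure (M.historyKernel π)).map (Preorder.frestrictLe n)) :=
          Measure.isProbabilityMeasure_map (by fun_prop)
        rw [← hmap, Measure.integral_compProd Integrable.of_finite]
        rfl
    _ = _ := by
        rw [integral_map (by fun_prop) (measurable_of_countable _).aestronglyMeasurable]
        refine integral_congr_ae (Filter.Eventually.of_forall fun x => ?_)
        exact integral_stateActionPMF π (M.P (x n).1 (x n).2) _

lemma integral_zero (ρ : PMF 𝒮) (f : 𝒮 × 𝒜 → ℝ) :
    ∫ x, f (x 0) ∂(M.trajectoryLaw π ρ) =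
      ∑ s, (ρ s).toReal * ∑ a, (π s a).toReal * f (s, a) := by
  rw [← integral_stateActionPMF]
  have hmap : (M.trajectoryLaw π ρ).map (fun x => x 0) = (stateActionPMF π ρ).toMeasure := by
    have h0 : (M.trajectoryLaw π ρ).map (Preorder.frestrictLe 0) =
        (stateActionPMF π ρ).toMeasure.map
          (MeasurableEquiv.piUnique fun _ : Finset.Iic 0 => 𝒮 × 𝒜).symm := by
      unfold trajectoryLaw Kernel.trajMeasure
      rw [Measure.map_comp _ _ (by fun_prop), Kernel.traj_map_frestrictLe,
        Kernel.partialTraj_self, Measure.id_comp]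
    have : (fun x : ℕ → 𝒮 × 𝒜 => x 0) = (MeasurableEquiv.piUnique fun _ : Finset.Iic 0 => 𝒮 × 𝒜) ∘
        Preorder.frestrictLe 0 := rfl
    rw [this, ← Measure.map_map (by fun_prop) (by fun_prop), h0,
      Measure.map_map (by fun_prop) (by fun_prop),
      MeasurableEquiv.self_comp_symm, Measure.map_id]
  rw [← hmap, integral_map (measurable_pi_apply 0).aemeasurable
    (measurable_of_countable f).aestronglyMeasurable]

/-- Averaging over `S_{n+1}`. -/
lemma integral_state_succ (ρ : PMF 𝒮) {n : ℕ} {F : (ℕ → 𝒮 × 𝒜) → 𝒮 → ℝ}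
    (hF : DependsOn F (Set.Iic n)) :
    ∫ x, F x (x (n + 1)).1 ∂(M.trajectoryLaw π ρ) =
      ∫ x, ∑ s, (M.P (x n).1 (x n).2 s).toReal * F x s ∂(M.trajectoryLaw π ρ) := by
  rw [M.integral_succ π ρ (F := fun x y => F x y.1) fun x y h => by simp only [hF h]]
  simp only [← Finset.sum_mul, PMF.sum_toReal_eq_one, one_mul]

/-- Averaging over `A_{n+1}`. -/
lemma integral_action_succ (ρ : PMF 𝒮) {n : ℕ} {F : (ℕ → 𝒮 × 𝒜) → 𝒮 → 𝒜 → ℝ}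
    (hF : DependsOn F (Set.Iic n)) :
    ∫ x, F x (x (n + 1)).1 (x (n + 1)).2 ∂(M.trajectoryLaw π ρ) =
      ∫ x, ∑ a, (π (x (n + 1)).1 a).toReal * F x (x (n + 1)).1 a ∂(M.trajectoryLaw π ρ) := by
  rw [M.integral_succ π ρ (F := fun x y => F x y.1 y.2) fun x y h => by simp only [hF h],
    M.integral_state_succ π ρ (F := fun x s => ∑ a, (π s a).toReal * F x s a)
      fun x y h => by simp only [hF h]]

/-- Averaging over `(A_{n+1}, S_{n+2})`. -/
lemma integral_state_step (ρ : PMF 𝒮) {n : ℕ} {F : (ℕ → 𝒮 × 𝒜) → 𝒮 → 𝒮 → ℝ}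
    (hF : DependsOn F (Set.Iic n)) :
    ∫ x, F x (x (n + 1)).1 (x (n + 2)).1 ∂(M.trajectoryLaw π ρ) =
      ∫ x, (M.transitionMatrix π).mulVec (F x (x (n + 1)).1) (x (n + 1)).1
        ∂(M.trajectoryLaw π ρ) := by
  rw [M.integral_state_succ π ρ (n := n + 1) (F := fun x s => F x (x (n + 1)).1 s)
    fun x y h => by
      have h1 : F x = F y := hF fun i hi => h i (Set.mem_Iic.2 (Nat.le_succ_of_le hi))
      have h2 : x (n + 1) = y (n + 1) := h (n + 1) (Set.mem_Iic.2 le_rfl)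
      simp only [h1, h2],
    M.integral_action_succ π ρ
      (F := fun x s a => ∑ s', (M.P s a s').toReal * F x s s')
      fun x y h => by simp only [hF h]]
  simp only [transitionMatrix_mulVec]

/-- Averaging over the states `S_{n+2}, …, S_{n+1+j}`. -/
lemma integral_state_pow [DecidableEq 𝒮] (ρ : PMF 𝒮) {n : ℕ} (j : ℕ)
    {F : (ℕ → 𝒮 × 𝒜) → 𝒮 → 𝒮 → ℝ} (hF : DependsOn F (Set.Iic n)) :
    ∫ x, F x (x (n + 1)).1 (x (n + 1 + j)).1 ∂(M.trajectoryLaw π ρ) =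
      ∫ x, (M.transitionMatrix π ^ j).mulVec (F x (x (n + 1)).1) (x (n + 1)).1
        ∂(M.trajectoryLaw π ρ) := by
  induction j generalizing F with
  | zero => simp
  | succ j ih =>
    -- The last transition is averaged first. For `j = 0` the state `S_{n+1}` is the one being left;
    -- for larger `j` it belongs to the history, hence the two cases.
    have hstep : ∫ x, F x (x (n + 1)).1 (x (n + 1 + (j + 1))).1 ∂(M.trajectoryLaw π ρ) =
        ∫ x, (M.transitionMatrix π).mulVec (F x (x (n + 1)).1) (x (n + 1 + j)).1
          ∂(M.trajectoryLaw π ρ) := by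
      cases j with
      | zero => exact M.integral_state_step π ρ hF
      | succ j =>
        have := M.integral_state_step π ρ (n := n + 1 + j)
          (F := fun x _ s' => F x (x (n + 1)).1 s') fun x y h => by
            have h1 : F x = F y := hF fun i hi => h i (Set.mem_Iic.2 (by
              have : i ≤ n := hi
              omega))
            have h2 : x (n + 1) = y (n + 1) := h (n + 1) (Set.mem_Iic.2 (by omega))
            simp only [h1, h2]
        exact this
    rw [hstep, ih (F := fun x s => (M.transitionMatrix π).mulVec (F x s))
      fun x y h => by simp only [hF h]]
    simp only [Matrix.mulVec_mulVec, ← pow_succ]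

lemma integral_state_pow_zero [DecidableEq 𝒮] (s : 𝒮) (n : ℕ) (f : 𝒮 → ℝ) :
    ∫ x, f (x n).1 ∂(M.trajectoryLaw π (PMF.pure s)) =
      (M.transitionMatrix π ^ n).mulVec f s := by
  have hpure : ∀ g : 𝒮 → ℝ, ∑ s', ((PMF.pure s) s').toReal * g s' = g s := fun g => by
    rw [Finset.sum_eq_single s]
    · simp
    · intro b _ hb
      simp [PMF.pure_apply, hb]
    · simp
  have h0 : ∀ f : 𝒮 × 𝒜 → ℝ, ∫ x, f (x 0) ∂(M.trajectoryLaw π (PMF.pure s)) =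
      ∑ a, (π s a).toReal * f (s, a) := fun f => by
    rw [M.integral_zero π, hpure fun s => ∑ a, (π s a).toReal * f (s, a)]
  cases n with
  | zero =>
    rw [h0 fun y => f y.1]
    simp [← Finset.sum_mul, PMF.sum_toReal_eq_one]
  | succ n =>
    have h1 := M.integral_state_pow π (PMF.pure s) n (n := 0) (F := fun _ _ s' => f s')
      fun _ _ _ => rfl
    rw [zero_add, add_comm 1 n] at h1
    rw [h1, M.integral_state_succ π (PMF.pure s) (n := 0)
      (F := fun _ s' => (M.transitionMatrix π ^ n).mulVec f s') fun _ _ _ => rfl,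
      h0 fun y => ∑ s', (M.P y.1 y.2 s').toReal * (M.transitionMatrix π ^ n).mulVec f s',
      ← transitionMatrix_mulVec, Matrix.mulVec_mulVec, ← pow_succ']

/-- The expected one-step reward of the policy. -/
noncomputable def meanReward (s : 𝒮) : ℝ := ∑ a, (π s a).toReal * M.reward s a

lemma integral_reward [DecidableEq 𝒮] (s : 𝒮) (n : ℕ) :
    ∫ x, M.reward (x n).1 (x n).2 ∂(M.trajectoryLaw π (PMF.pure s)) =
      (M.transitionMatrix π ^ n).mulVec (M.meanReward π) s := by
  rw [← M.integral_state_pow_zero]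
  cases n with
  | zero =>
    rw [M.integral_zero π _ fun y => M.reward y.1 y.2,
      M.integral_zero π _ fun y => M.meanReward π y.1]
    simp only [← Finset.sum_mul, PMF.sum_toReal_eq_one, one_mul]
    rfl
  | succ n =>
    exact M.integral_action_succ π _ (F := fun _ s a => M.reward s a) fun _ _ _ => rfl

/-- Rewards in `[0, 1]` make `γ ^ n` a dominating series, so expectation and sum can be exchanged.
-/
lemma valueFunction_apply [DecidableEq 𝒮] (s : 𝒮) :
    HasSum (fun n => M.γ ^ n * (M.transitionMatrix π ^ n).mulVec (M.meanReward π) s)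
      (M.valueFunction π s) := by
  have hdep : ∀ n, DependsOn (fun x : ℕ → 𝒮 × 𝒜 => M.γ ^ n * M.reward (x n).1 (x n).2)
      (Set.Iic n) := fun n x y h => by
    simp only [h n (Set.mem_Iic.2 le_rfl)]
  have hγ := M.γ_pos.le
  have hbound : ∀ (n : ℕ) (x : ℕ → 𝒮 × 𝒜), ‖M.γ ^ n * M.reward (x n).1 (x n).2‖ ≤ M.γ ^ n := by
    intro n x
    have := M.reward_mem (x n).1 (x n).2
    rw [Real.norm_of_nonneg (mul_nonneg (pow_nonneg hγ n) this.1)]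
    exact mul_le_of_le_one_right (pow_nonneg hγ n) this.2
  have hsum : HasSum (fun n => ∫ x, M.γ ^ n * M.reward (x n).1 (x n).2
      ∂(M.trajectoryLaw π (PMF.pure s))) (M.valueFunction π s) := by
    refine hasSum_integral_of_dominated_convergence (fun n _ => M.γ ^ n)
      (fun n => (hdep n).measurable_of_finite.aestronglyMeasurable)
      (fun n => Filter.Eventually.of_forall (hbound n))
      (Filter.Eventually.of_forall fun _ => summable_geometric_of_lt_one hγ M.γ_lt_one)
      (integrable_const _) (Filter.Eventually.of_forall fun x => ?_)
    exact (Summable.of_norm_bounded (summable_geometric_of_lt_one hγ M.γ_lt_one)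
      fun n => hbound n x).hasSum
  convert hsum using 2 with n
  rw [integral_const_mul, integral_reward]

/-- The Bellman equation of the policy. -/
lemma valueFunction_eq (s : 𝒮) :
    M.valueFunction π s = M.meanReward π s +
      M.γ * (M.transitionMatrix π).mulVec (M.valueFunction π) s := by
  classical
  refine (M.valueFunction_apply π s).unique ?_
  rw [← hasSum_nat_add_iff' 1]
  have h : HasSum (fun n => M.γ * ∑ s', M.transitionMatrix π s s' *
      (M.γ ^ n * (M.transitionMatrix π ^ n).mulVec (M.meanReward π) s'))
      (M.γ * ∑ s', M.transitionMatrix π s s' * M.valueFunction π s') :=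
    (hasSum_sum fun s' _ => (M.valueFunction_apply π s').mul_left _).mul_left _
  have h₁ : (fun n => M.γ ^ (n + 1) *
      (M.transitionMatrix π ^ (n + 1)).mulVec (M.meanReward π) s) =
      fun n => M.γ * ∑ s', M.transitionMatrix π s s' *
        (M.γ ^ n * (M.transitionMatrix π ^ n).mulVec (M.meanReward π) s') := by
    ext n
    rw [pow_succ' (M.transitionMatrix π), ← Matrix.mulVec_mulVec]
    conv_lhs => rw [Matrix.mulVec, dotProduct]
    rw [Finset.mul_sum, Finset.mul_sum]
    refine Finset.sum_congr rfl fun s' _ => ?_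
    ring
  rw [h₁, Finset.sum_range_one, pow_zero, pow_zero, one_mul, Matrix.one_mulVec,
    add_sub_cancel_left]
  exact h

end Expectations

end DiscountedMDP

/-! ### Eligibility traces and their truncation. -/

section Trace

variable {𝒮 𝒜 : Type*} [DecidableEq 𝒮]

/-- The eligibility trace at time `k`, restricted to the last `τ + 1` visited states. -/
noncomputable def truncatedTrace (γ lam : ℝ) (x : ℕ → 𝒮 × 𝒜) (k τ : ℕ) : EuclideanSpace ℝ 𝒮 :=
  ∑ i ∈ Finset.range (τ + 1), (γ * lam) ^ i • EuclideanSpace.single (x (k - i)).1 (1 : ℝ)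

lemma toLp_eligibilityTrace (γ lam : ℝ) (x : ℕ → 𝒮 × 𝒜) (k : ℕ) :
    WithLp.toLp 2 (eligibilityTrace γ lam x k) = truncatedTrace γ lam x k k := by
  ext s
  simp only [eligibilityTrace, truncatedTrace, WithLp.ofLp_sum, WithLp.ofLp_smul,
    Finset.sum_apply, Pi.smul_apply, smul_eq_mul]
  rw [← Finset.sum_range_reflect]
  refine Finset.sum_congr rfl fun i hi => ?_
  have : i ≤ k := Nat.lt_succ_iff.1 (Finset.mem_range.1 hi)
  rw [show k + 1 - 1 - i = k - i by omega, show k - (k - i) = i by omega]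
  simp [eq_comm]

variable [Fintype 𝒮]

lemma inner_truncatedTrace (γ lam : ℝ) (x : ℕ → 𝒮 × 𝒜) (k τ : ℕ) (v : EuclideanSpace ℝ 𝒮) :
    inner ℝ v (truncatedTrace γ lam x k τ) =
      ∑ i ∈ Finset.range (τ + 1), (γ * lam) ^ i * v (x (k - i)).1 := by
  rw [truncatedTrace, inner_sum]
  refine Finset.sum_congr rfl fun i _ => ?_
  rw [inner_smul_right, EuclideanSpace.inner_single_right]
  simp

lemma norm_pow_smul_single {c : ℝ} (hc : 0 ≤ c) (i : ℕ) (s : 𝒮) :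
    ‖c ^ i • EuclideanSpace.single s (1 : ℝ)‖ = c ^ i := by
  rw [norm_smul, PiLp.norm_single, norm_one, mul_one,
    Real.norm_of_nonneg (pow_nonneg hc i)]

lemma norm_truncatedTrace_le {γ lam : ℝ} (hc0 : 0 ≤ γ * lam) (hc1 : γ * lam < 1)
    (x : ℕ → 𝒮 × 𝒜) (k τ : ℕ) : ‖truncatedTrace γ lam x k τ‖ ≤ 1 / (1 - γ * lam) := by
  refine (norm_sum_le _ _).trans ?_
  simp only [norm_pow_smul_single hc0]
  rw [one_div, ← tsum_geometric_of_lt_one hc0 hc1]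
  exact (summable_geometric_of_lt_one hc0 hc1).sum_le_tsum _ fun i _ => pow_nonneg hc0 i

/-- The difference is the geometric tail over `τ < i ≤ k`; at the truncation level it is at most `α
/ (1 - γλ)`. -/
lemma norm_truncatedTrace_sub_le {γ lam : ℝ} (hc0 : 0 ≤ γ * lam) (hc1 : γ * lam < 1)
    (x : ℕ → 𝒮 × 𝒜) {k τ : ℕ} (hτ : τ ≤ k) :
    ‖truncatedTrace γ lam x k k - truncatedTrace γ lam x k τ‖ ≤
      (γ * lam) ^ (τ + 1) / (1 - γ * lam) := by
  rw [truncatedTrace, truncatedTrace, ← Finset.sum_Ico_eq_sub _ (by omega)]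
  refine (norm_sum_le _ _).trans ?_
  simp only [norm_pow_smul_single hc0]
  rw [Finset.sum_Ico_eq_sum_range]
  simp only [pow_add, ← Finset.mul_sum]
  rw [div_eq_mul_inv, ← tsum_geometric_of_lt_one hc0 hc1]
  exact mul_le_mul_of_nonneg_left
    ((summable_geometric_of_lt_one hc0 hc1).sum_le_tsum _ fun i _ => pow_nonneg hc0 i)
    (by positivity)

end Trace

/-! ### Pathwise bounds on the TD(λ) iterates. -/

section Path

variable {𝒮 𝒜 : Type*} [DecidableEq 𝒮] (M : DiscountedMDP 𝒮 𝒜) (lam α : ℝ)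
  (V₀ : EuclideanSpace ℝ 𝒮)

lemma tdLambda_succ (x : ℕ → 𝒮 × 𝒜) (k : ℕ) :
    tdLambda M lam (fun _ => α) V₀ x (k + 1) = tdLambda M lam (fun _ => α) V₀ x k +
      (α * temporalDifference M (tdLambda M lam (fun _ => α) V₀ x k) (x k).1 (x k).2
        (x (k + 1)).1) • truncatedTrace M.γ lam x k k := by
  rw [← toLp_eligibilityTrace]
  ext s
  rw [tdLambda]
  simp only [PiLp.add_apply, PiLp.smul_apply, smul_eq_mul]
  ring

lemma dependsOn_eligibilityTrace (γ : ℝ) (k : ℕ) :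
    DependsOn (fun x : ℕ → 𝒮 × 𝒜 => eligibilityTrace γ lam x k) (Set.Iic k) := by
  intro x y h
  ext s
  refine Finset.sum_congr rfl fun i hi => ?_
  rw [h i (Nat.lt_succ_iff.1 (Finset.mem_range.1 hi))]

lemma dependsOn_tdLambda (a : ℕ → ℝ) (k : ℕ) :
    DependsOn (fun x => tdLambda M lam a V₀ x k) (Set.Iic k) := by
  induction k with
  | zero => intro x y _; rfl
  | succ k ih =>
    intro x y h
    have h₁ : tdLambda M lam a V₀ x k = tdLambda M lam a V₀ y k :=
      ih fun i hi => h i (Set.mem_Iic.2 (Nat.le_succ_of_le hi))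
    have h₂ : eligibilityTrace M.γ lam x k = eligibilityTrace M.γ lam y k :=
      dependsOn_eligibilityTrace lam M.γ k fun i hi => h i (Set.mem_Iic.2 (Nat.le_succ_of_le hi))
    have h₃ := h k (Set.mem_Iic.2 (Nat.le_succ k))
    have h₄ := h (k + 1) (Set.mem_Iic.2 le_rfl)
    simp only [tdLambda, h₁, h₂, h₃, h₄]

omit [DecidableEq 𝒮]

variable [Fintype 𝒮]

lemma EuclideanSpace.abs_apply_le_norm (v : EuclideanSpace ℝ 𝒮) (s : 𝒮) : |v s| ≤ ‖v‖ :=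
  PiLp.norm_apply_le v s

lemma abs_temporalDifference_le (V : EuclideanSpace ℝ 𝒮) (s : 𝒮) (a : 𝒜) (s' : 𝒮) :
    |temporalDifference M V s a s'| ≤ 1 + 2 * ‖V‖ := by
  have h₁ := M.reward_mem s a
  have h₂ := abs_le.1 (EuclideanSpace.abs_apply_le_norm V s)
  have h₃ : |M.γ * V s'| ≤ ‖V‖ := by
    rw [abs_mul, abs_of_pos M.γ_pos]
    exact (mul_le_of_le_one_left (abs_nonneg _) M.γ_lt_one.le).trans
      (EuclideanSpace.abs_apply_le_norm V s')
  have h₃ := abs_le.1 h₃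
  unfold temporalDifference
  exact abs_le.2 ⟨by linarith [h₁.1], by linarith [h₁.2]⟩

lemma abs_temporalDifference_sub_le (V W : EuclideanSpace ℝ 𝒮) (s : 𝒮) (a : 𝒜) (s' : 𝒮) :
    |temporalDifference M V s a s' - temporalDifference M W s a s'| ≤ 2 * ‖V - W‖ := by
  have h₂ := abs_le.1 (EuclideanSpace.abs_apply_le_norm (V - W) s)
  have h₃ : |M.γ * (V - W) s'| ≤ ‖V - W‖ := by
    rw [abs_mul, abs_of_pos M.γ_pos]
    exact (mul_le_of_le_one_left (abs_nonneg _) M.γ_lt_one.le).trans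
      (EuclideanSpace.abs_apply_le_norm (V - W) s')
  have h₃ := abs_le.1 h₃
  simp only [PiLp.sub_apply] at h₂ h₃
  unfold temporalDifference
  exact abs_le.2 ⟨by linarith, by linarith⟩

lemma norm_tdLambda_sub_le [DecidableEq 𝒮] (hα : 0 ≤ α) (hc0 : 0 ≤ M.γ * lam)
    (hc1 : M.γ * lam < 1) (x : ℕ → 𝒮 × 𝒜) (m j : ℕ) (hj : j * (α / (1 - M.γ * lam)) ≤ 1 / 4) :
    ‖tdLambda M lam (fun _ => α) V₀ x (m + j) - tdLambda M lam (fun _ => α) V₀ x m‖ ≤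
      2 * (j * (α / (1 - M.γ * lam))) * (1 + 2 * ‖tdLambda M lam (fun _ => α) V₀ x m‖) := by
  set η := α / (1 - M.γ * lam) with hη
  have hη0 : 0 ≤ η := div_nonneg hα (by linarith)
  set V := tdLambda M lam (fun _ => α) V₀ x
  set B := 1 + 2 * ‖V m‖ with hB
  have hB0 : 0 ≤ B := by positivity
  induction j with
  | zero => simp
  | succ j ih =>
    push_cast at hj ⊢
    specialize ih (by nlinarith)
    rw [← add_assoc, show V (m + j + 1) = V (m + j) + (α * temporalDifference M (V (m + j))
      (x (m + j)).1 (x (m + j)).2 (x (m + j + 1)).1) •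
        truncatedTrace M.γ lam x (m + j) (m + j) from tdLambda_succ M lam α V₀ x (m + j)]
    set d := temporalDifference M (V (m + j)) (x (m + j)).1 (x (m + j)).2 (x (m + j + 1)).1
    have hd : |d| ≤ B + 2 * ‖V (m + j) - V m‖ := by
      have h₁ := abs_temporalDifference_sub_le M (V (m + j)) (V m) (x (m + j)).1 (x (m + j)).2
        (x (m + j + 1)).1
      have h₂ := abs_temporalDifference_le M (V m) (x (m + j)).1 (x (m + j)).2
        (x (m + j + 1)).1
      have := abs_sub_abs_le_abs_sub d (temporalDifference M (V m) (x (m + j)).1 (x (m + j)).2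
        (x (m + j + 1)).1)
      linarith
    have hstep : ‖(α * d) • truncatedTrace M.γ lam x (m + j) (m + j)‖ ≤ η * |d| := by
      rw [norm_smul, Real.norm_eq_abs, abs_mul, abs_of_nonneg hα, hη, div_mul_eq_mul_div,
        div_eq_mul_one_div]
      exact mul_le_mul_of_nonneg_left (norm_truncatedTrace_le hc0 hc1 x _ _) (by positivity)
    have htri : ‖V (m + j) + (α * d) • truncatedTrace M.γ lam x (m + j) (m + j) - V m‖ ≤
        ‖V (m + j) - V m‖ + η * |d| := by
      rw [add_sub_right_comm]
      exact (norm_add_le _ _).trans (by linarith)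
    refine htri.trans ?_
    have h₁ : η * |d| ≤ η * (B + 2 * (2 * (j * η) * B)) :=
      mul_le_mul_of_nonneg_left (by linarith) hη0
    -- As `4 j η ≤ 1`, the displacement so far at most doubles the bound `B` on the temporal
    -- difference, so each step adds at most `2 η B`.
    have h₂ : η * B * (4 * (j * η)) ≤ η * B * 1 :=
      mul_le_mul_of_nonneg_left (by nlinarith) (by positivity)
    nlinarith

end Path

/-! ### Deterministic one-step expansion with delayed quantities. -/

section OneStep

variable {E : Type*} [NormedAddCommGroup E] [InnerProductSpace ℝ E]

/-- The one-step expansion of the squared norm, where the current iterate `y`, the temporal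
difference `d` and the trace `Z` are replaced by delayed versions `y'`, `d'`, `Z'`. -/
lemma norm_sq_add_smul_le {y y' Z Z' : E} {α ε h B d d' : ℝ} (hα : 0 ≤ α) (hh0 : 0 < h)
    (hh1 : h ≤ 1) (hB : 0 ≤ B) (hαε : α / h ≤ ε) (hε : ε ≤ 1 / 100)
    (hZ : ‖Z‖ ≤ 1 / h) (hZZ : ‖Z - Z'‖ ≤ α / h) (hy : ‖y - y'‖ ≤ 2 * ε * B)
    (hd' : |d'| ≤ B) (hdd : |d - d'| ≤ 2 * ‖y - y'‖) :
    ‖y + (α * d) • Z‖ ^ 2 ≤ ‖y‖ ^ 2 + 2 * α * (d' * inner ℝ y' Z') +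
      α * ε / h * (6 * B ^ 2 + 10 * (B * ‖y'‖)) := by
  have hε0 : 0 ≤ ε := (div_nonneg hα hh0.le).trans hαε
  have hαh : α ≤ α / h := by rw [le_div_iff₀ hh0]; nlinarith
  -- `|d| ≤ (1 + 4 ε) B`, and `ε ≤ 1 / 100` gives `26 / 25`.
  have hd : |d| ≤ 26 / 25 * B := by
    have := abs_sub_abs_le_abs_sub d d'
    nlinarith
  have hd2 : |d - d'| ≤ 4 * ε * B := by linarith
  have e₁ : d * inner ℝ (y - y') Z ≤ 26 / 25 * B * (2 * ε * B * (1 / h)) := by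
    refine (le_abs_self _).trans ?_
    rw [abs_mul]
    refine mul_le_mul hd ((abs_real_inner_le_norm _ _).trans ?_) (abs_nonneg _) (by positivity)
    exact mul_le_mul hy hZ (norm_nonneg _) (by positivity)
  have e₂ : (d - d') * inner ℝ y' Z ≤ 4 * ε * B * (‖y'‖ * (1 / h)) := by
    refine (le_abs_self _).trans ?_
    rw [abs_mul]
    refine mul_le_mul hd2 ((abs_real_inner_le_norm _ _).trans ?_) (abs_nonneg _) (by positivity)
    exact mul_le_mul_of_nonneg_left hZ (norm_nonneg _)
  have e₃ : d' * inner ℝ y' (Z - Z') ≤ B * (‖y'‖ * (ε * (1 / h))) := by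
    refine (le_abs_self _).trans ?_
    rw [abs_mul]
    refine mul_le_mul hd' ((abs_real_inner_le_norm _ _).trans ?_) (abs_nonneg _) hB
    refine mul_le_mul_of_nonneg_left (hZZ.trans ?_) (norm_nonneg _)
    rw [div_eq_mul_one_div]
    exact mul_le_mul_of_nonneg_right (hαh.trans hαε) (by positivity)
  have e₄ : ‖(α * d) • Z‖ ^ 2 ≤ α * ε / h * (11 / 10 * B ^ 2) := by
    have h₁ : ‖(α * d) • Z‖ ≤ α / h * (26 / 25 * B) := by
      rw [norm_smul, Real.norm_eq_abs, abs_mul, abs_of_nonneg hα]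
      calc α * |d| * ‖Z‖ ≤ α * (26 / 25 * B) * (1 / h) := by gcongr
        _ = _ := by ring
    have h₂ : (α / h * (26 / 25 * B)) ^ 2 = α / h * (α / h) * (676 / 625 * B ^ 2) := by ring
    have h₃ : α / h * (α / h) ≤ α * ε / h := by
      rw [mul_div_right_comm]
      exact mul_le_mul_of_nonneg_left hαε (by positivity)
    calc ‖(α * d) • Z‖ ^ 2 ≤ (α / h * (26 / 25 * B)) ^ 2 := by gcongr
      _ ≤ α * ε / h * (676 / 625 * B ^ 2) := by
        rw [h₂]; exact mul_le_mul_of_nonneg_right h₃ (by positivity)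
      _ ≤ _ := mul_le_mul_of_nonneg_left (by nlinarith [sq_nonneg B]) (by positivity)
  -- The variables are replaced one at a time: iterate, then temporal difference, then trace.
  have hsplit : inner ℝ y ((α * d) • Z) = α * (d * inner ℝ (y - y') Z +
      (d - d') * inner ℝ y' Z + d' * inner ℝ y' (Z - Z') + d' * inner ℝ y' Z') := by
    rw [inner_smul_right, inner_sub_left, inner_sub_right]
    ring
  have hkey : α * (d * inner ℝ (y - y') Z + (d - d') * inner ℝ y' Z +
      d' * inner ℝ y' (Z - Z') + d' * inner ℝ y' Z') ≤
      α * (26 / 25 * B * (2 * ε * B * (1 / h)) + 4 * ε * B * (‖y'‖ * (1 / h)) +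
        B * (‖y'‖ * (ε * (1 / h))) + d' * inner ℝ y' Z') :=
    mul_le_mul_of_nonneg_left (by linarith) hα
  rw [norm_add_sq_real, hsplit]
  have hexp : α * (26 / 25 * B * (2 * ε * B * (1 / h)) + 4 * ε * B * (‖y'‖ * (1 / h)) +
        B * (‖y'‖ * (ε * (1 / h))) + d' * inner ℝ y' Z') =
      α * ε / h * (52 / 25 * B ^ 2 + 5 * (B * ‖y'‖)) + α * (d' * inner ℝ y' Z') := by
    ring
  have hq : 0 ≤ α * ε / h * B ^ 2 := by positivity
  linarith

/-- The one-step expansion with the delayed residual `y'` as the only random error term. -/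
lemma norm_sq_add_smul_le' {y y' Z Z' : E} {α ε h b B d d' : ℝ} (hα : 0 ≤ α) (hh0 : 0 < h)
    (hh1 : h ≤ 1) (hB : 0 ≤ B) (hαε : α / h ≤ ε) (hε : ε ≤ 1 / 100)
    (hZ : ‖Z‖ ≤ 1 / h) (hZZ : ‖Z - Z'‖ ≤ α / h) (hy : ‖y - y'‖ ≤ 2 * ε * B)
    (hd' : |d'| ≤ B) (hdd : |d - d'| ≤ 2 * ‖y - y'‖) (hBb : B ≤ b + 2 * ‖y'‖) :
    ‖y + (α * d) • Z‖ ^ 2 ≤ ‖y‖ ^ 2 + 2 * α * (d' * inner ℝ y' Z') +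
      α * ε / h * (17 * b ^ 2 + 73 * ‖y'‖ ^ 2) := by
  refine (norm_sq_add_smul_le hα hh0 hh1 hB hαε hε hZ hZZ hy hd' hdd).trans ?_
  have hε0 : 0 ≤ ε := (div_nonneg hα hh0.le).trans hαε
  have hB2 : B ^ 2 ≤ (b + 2 * ‖y'‖) ^ 2 := by gcongr
  have hBX : B * ‖y'‖ ≤ (b + 2 * ‖y'‖) * ‖y'‖ := by gcongr
  have : 6 * B ^ 2 + 10 * (B * ‖y'‖) ≤ 17 * b ^ 2 + 73 * ‖y'‖ ^ 2 := by
    nlinarith [sq_nonneg (b - 2 * ‖y'‖), sq_nonneg (b - ‖y'‖)]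
  have hq : 0 ≤ α * ε / h := by positivity
  nlinarith [mul_le_mul_of_nonneg_left this hq]

omit [InnerProductSpace ℝ E] in
lemma norm_sq_le_of_norm_sub_le {y y' : E} {ε b B : ℝ} (hε0 : 0 ≤ ε) (hε : ε ≤ 1 / 100)
    (hy : ‖y - y'‖ ≤ 2 * ε * B) (hBb : B ≤ b + 2 * ‖y'‖) :
    ‖y‖ ^ 2 ≤ 7 / 5 * ‖y'‖ ^ 2 + 20 * (ε ^ 2 * b ^ 2) := by
  have h₁ : ‖y‖ ≤ ‖y'‖ + ‖y - y'‖ := by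
    have := norm_add_le y' (y - y')
    rwa [add_sub_cancel] at this
  have hX := norm_nonneg y'
  have h₂ : ‖y‖ ≤ 26 / 25 * ‖y'‖ + 2 * (ε * b) := by nlinarith
  have h₃ : ‖y‖ ^ 2 ≤ (26 / 25 * ‖y'‖ + 2 * (ε * b)) ^ 2 := by gcongr
  nlinarith [sq_nonneg (‖y'‖ / 2 - 4 * (ε * b))]

end OneStep

/-! ### Comparison with stationary expectations. -/

section Rows

open Matrix

variable {n : Type*} [Fintype n] [DecidableEq n]

lemma abs_mulVec_le_of_mem_rowStochastic {P : Matrix n n ℝ} (hP : P ∈ rowStochastic ℝ n)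
    {f : n → ℝ} {C : ℝ} (hf : ∀ s, |f s| ≤ C) (s : n) : |(P *ᵥ f) s| ≤ C := by
  simp only [mulVec, dotProduct]
  calc |∑ j, P s j * f j| ≤ ∑ j, P s j * C := by
        refine (Finset.abs_sum_le_sum_abs _ _).trans (Finset.sum_le_sum fun j _ => ?_)
        rw [abs_mul, abs_of_nonneg (hP.1 s j)]
        exact mul_le_mul_of_nonneg_left (hf j) (hP.1 s j)
    _ = C := by rw [← Finset.sum_mul, sum_row_of_mem_rowStochastic hP, one_mul]

/-- After the mixing time, expectations are close to stationary expectations. -/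
lemma sum_mul_pow_mulVec_le_stationary {P : Matrix n n ℝ} (hP : P ∈ rowStochastic ℝ n)
    {κ q f : n → ℝ} {δ C : ℝ} {t : ℕ} (ht : ∀ s, tvDistance ((P ^ t) s) κ ≤ δ)
    (hq0 : ∀ i, 0 ≤ q i) (hq1 : ∑ i, q i = 1) (hf : ∀ s, |f s| ≤ C) (hC : 0 ≤ C) (l : ℕ) :
    ∑ s, q s * (P ^ (t + l) *ᵥ f) s ≤ ∑ s, κ s * f s + 2 * δ * C := by
  have hPl := pow_mem hP l
  have h₁ := sum_abs_vecMul_sub_le (R := P ^ t) (q := q ᵥ* P ^ l) (κ := κ) (δ := δ)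
    (nonneg_vecMul_of_mem_rowStochastic hPl hq0)
    (by rw [sum_vecMul_eq q (sum_row_of_mem_rowStochastic hPl), hq1, one_mul]) ht
  have h₂ : ∑ s, q s * (P ^ (t + l) *ᵥ f) s = ∑ s, ((q ᵥ* P ^ l) ᵥ* P ^ t) s * f s := by
    rw [vecMul_vecMul, ← pow_add, add_comm l t]
    exact dotProduct_mulVec q (P ^ (t + l)) f
  have h₃ : ∑ s, ((q ᵥ* P ^ l) ᵥ* P ^ t) s * f s - ∑ s, κ s * f s ≤
      ∑ s, |((q ᵥ* P ^ l) ᵥ* P ^ t) s - κ s| * C := by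
    rw [← Finset.sum_sub_distrib]
    refine Finset.sum_le_sum fun s _ => ?_
    rw [← sub_mul]
    refine (le_abs_self _).trans ?_
    rw [abs_mul]
    exact mul_le_mul_of_nonneg_left (hf s) (abs_nonneg _)
  rw [← Finset.sum_mul] at h₃
  have := mul_le_mul_of_nonneg_right h₁ hC
  linarith

end Rows

/-! ### The expected drift along the trajectory. -/

namespace DiscountedMDP

variable {𝒮 𝒜 : Type*} [Fintype 𝒮] [MeasurableSpace 𝒮] [DiscreteMeasurableSpace 𝒮]
  [Fintype 𝒜] [MeasurableSpace 𝒜] [DiscreteMeasurableSpace 𝒜]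
  (M : DiscountedMDP 𝒮 𝒜) (π : Policy 𝒮 𝒜)

/-- The mean temporal difference of `V` is the Bellman residual of `V - V_π`. -/
lemma mean_temporalDifference (V : EuclideanSpace ℝ 𝒮) (s : 𝒮) :
    ∑ a, (π s a).toReal * ∑ s', (M.P s a s').toReal * temporalDifference M V s a s' =
      (M.γ • (M.transitionMatrix π).mulVec (V - M.valueFunction π) - (V - M.valueFunction π)) s := by
  have h₁ : ∀ a, ∑ s', (M.P s a s').toReal * temporalDifference M V s a s' =
      M.reward s a + M.γ * ∑ s', (M.P s a s').toReal * V s' - V s := fun a => by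
    simp only [temporalDifference, mul_sub, mul_add, Finset.sum_sub_distrib,
      Finset.sum_add_distrib, ← Finset.sum_mul, PMF.sum_toReal_eq_one, one_mul, Finset.mul_sum]
    congr 2
    exact Finset.sum_congr rfl fun _ _ => by ring
  have h₂ : ∑ a, (π s a).toReal * ∑ s', (M.P s a s').toReal * temporalDifference M V s a s' =
      M.meanReward π s + M.γ * (M.transitionMatrix π).mulVec V s - V s := by
    simp only [h₁, mul_sub, mul_add, Finset.sum_sub_distrib, Finset.sum_add_distrib,
      ← Finset.sum_mul, PMF.sum_toReal_eq_one, one_mul, transitionMatrix_mulVec, meanReward,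
      Finset.mul_sum]
    congr 2
    exact Finset.sum_congr rfl fun _ _ => Finset.sum_congr rfl fun _ _ => by ring
  rw [h₂, Matrix.mulVec_sub]
  simp only [Pi.sub_apply, Pi.smul_apply, smul_eq_mul]
  linarith [M.valueFunction_eq π s]

/-- Averaging over `A_{n+1+i}` and `S_{n+2+i}`, and then over `S_{n+2}, …, S_{n+1+i}`. -/
lemma integral_lag [DecidableEq 𝒮] (ρ : PMF 𝒮) {n : ℕ} (i : ℕ)
    {G : (ℕ → 𝒮 × 𝒜) → 𝒮 → 𝒮 → 𝒜 → 𝒮 → ℝ} (hG : DependsOn G (Set.Iic n)) :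
    ∫ x, G x (x (n + 1)).1 (x (n + 1 + i)).1 (x (n + 1 + i)).2 (x (n + 1 + i + 1)).1
        ∂(M.trajectoryLaw π ρ) =
      ∫ x, (M.transitionMatrix π ^ i).mulVec (fun s => ∑ a, (π s a).toReal *
          ∑ s', (M.P s a s').toReal * G x (x (n + 1)).1 s a s') (x (n + 1)).1
        ∂(M.trajectoryLaw π ρ) := by
  rw [M.integral_state_succ π ρ (n := n + 1 + i)
    (F := fun x s' => G x (x (n + 1)).1 (x (n + 1 + i)).1 (x (n + 1 + i)).2 s')
    fun x y h => by
      have h₁ : G x = G y := hG fun j hj => h j (Set.mem_Iic.2 (by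
        have : j ≤ n := hj
        omega))
      have h₂ : x (n + 1) = y (n + 1) := h (n + 1) (Set.mem_Iic.2 (by omega))
      have h₃ : x (n + 1 + i) = y (n + 1 + i) := h (n + 1 + i) (Set.mem_Iic.2 le_rfl)
      simp only [h₁, h₂, h₃]]
  rw [← M.integral_state_pow π ρ i (F := fun x s₀ s => ∑ a, (π s a).toReal *
    ∑ s', (M.P s a s').toReal * G x s₀ s a s') fun x y h => by simp only [hG h]]
  cases i with
  | zero =>
    exact M.integral_action_succ π ρ (F := fun x s a => ∑ s', (M.P s a s').toReal * G x s s a s')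
      fun x y h => by simp only [hG h]
  | succ i =>
    exact M.integral_action_succ π ρ (n := n + 1 + i)
      (F := fun x s a => ∑ s', (M.P s a s').toReal * G x (x (n + 1)).1 s a s')
      fun x y h => by
        have h₁ : G x = G y := hG fun j hj => h j (Set.mem_Iic.2 (by
          have : j ≤ n := hj
          omega))
        have h₂ : x (n + 1) = y (n + 1) := h (n + 1) (Set.mem_Iic.2 (by omega))
        simp only [h₁, h₂]

/-- Averaging a function of `S_{m+1+l}` and of the history up to time `m`. -/
lemma integral_state_lag [DecidableEq 𝒮] (ρ : PMF 𝒮) {m : ℕ} (l : ℕ)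
    {F : (ℕ → 𝒮 × 𝒜) → 𝒮 → ℝ} (hF : DependsOn F (Set.Iic m)) :
    ∫ x, F x (x (m + 1 + l)).1 ∂(M.trajectoryLaw π ρ) =
      ∫ x, ∑ s, (M.P (x m).1 (x m).2 s).toReal * (M.transitionMatrix π ^ l).mulVec (F x) s
        ∂(M.trajectoryLaw π ρ) := by
  rw [M.integral_state_pow π ρ l (F := fun x _ s => F x s) fun x y h => by simp only [hF h],
    M.integral_state_succ π ρ (F := fun x s => (M.transitionMatrix π ^ l).mulVec (F x) s)
      fun x y h => by simp only [hF h]]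

variable {M π}

/-- One lag of the expected drift: the correlation between `V_m - V_π` at the state visited `i`
steps ago and the current temporal difference of `V_m`. -/
lemma integral_mul_temporalDifference_le [DecidableEq 𝒮] {κ : 𝒮 → ℝ} {δ : ℝ} {t : ℕ}
    (ht : ∀ s, tvDistance ((M.transitionMatrix π ^ t) s) κ ≤ δ) (ρ : PMF 𝒮) {m : ℕ} (i l : ℕ)
    {V : (ℕ → 𝒮 × 𝒜) → EuclideanSpace ℝ 𝒮} (hV : DependsOn V (Set.Iic m)) :
    ∫ x, (V x - M.valueFunction π) (x (m + 1 + (t + l))).1 *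
        temporalDifference M (V x) (x (m + 1 + (t + l) + i)).1 (x (m + 1 + (t + l) + i)).2
          (x (m + 1 + (t + l) + i + 1)).1 ∂(M.trajectoryLaw π ρ) ≤
      ∫ x, (∑ s, κ s * ((V x - M.valueFunction π) s *
        (M.transitionMatrix π ^ i).mulVec (M.γ • (M.transitionMatrix π).mulVec
          (V x - M.valueFunction π) - (V x - M.valueFunction π)) s) +
        2 * δ * (‖V x - M.valueFunction π‖ * (2 * ‖V x - M.valueFunction π‖)))
        ∂(M.trajectoryLaw π ρ) := by
  set P := M.transitionMatrix π
  have hP : P ∈ Matrix.rowStochastic ℝ 𝒮 := M.transitionMatrix_mem_rowStochastic π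
  set f : (ℕ → 𝒮 × 𝒜) → 𝒮 → ℝ := fun x s => (V x - M.valueFunction π) s *
    (P ^ i).mulVec (M.γ • P.mulVec (V x - M.valueFunction π) - (V x - M.valueFunction π)) s
    with hf
  have hfdep : DependsOn f (Set.Iic m) := fun x y h => by
    simp only [hf, hV h]
  have h₁ := M.integral_lag π ρ (n := m + (t + l)) i
    (G := fun x s₀ s a s' => (V x - M.valueFunction π) s₀ * temporalDifference M (V x) s a s')
    fun x y h => by
      have : V x = V y := hV fun j hj => h j (Set.mem_Iic.2 (by
        have : j ≤ m := hj
        omega))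
      simp only [this]
  have hinner : ∀ (x : ℕ → 𝒮 × 𝒜) (s₀ : 𝒮), (P ^ i).mulVec (fun s => ∑ a, (π s a).toReal *
      ∑ s', (M.P s a s').toReal * ((V x - M.valueFunction π) s₀ *
        temporalDifference M (V x) s a s')) s₀ = f x s₀ := by
    intro x s₀
    have : (fun s => ∑ a, (π s a).toReal * ∑ s', (M.P s a s').toReal *
        ((V x - M.valueFunction π) s₀ * temporalDifference M (V x) s a s')) =
        (V x - M.valueFunction π) s₀ •
          (M.γ • P.mulVec (V x - M.valueFunction π) - (V x - M.valueFunction π)) := by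
      ext s
      rw [Pi.smul_apply, ← M.mean_temporalDifference π (V x) s, smul_eq_mul]
      simp only [Finset.mul_sum]
      exact Finset.sum_congr rfl fun _ _ => Finset.sum_congr rfl fun _ _ => by ring
    rw [this, Matrix.mulVec_smul]
    rfl
  rw [show m + 1 + (t + l) = m + (t + l) + 1 by ring, h₁]
  simp only [P, hinner]
  rw [show m + (t + l) + 1 = m + 1 + (t + l) by ring, M.integral_state_lag π ρ (t + l) hfdep]
  have hdep : ∀ g : EuclideanSpace ℝ 𝒮 → 𝒮 × 𝒜 → ℝ,
      DependsOn (fun x => g (V x) (x m)) (Set.Iic m) := fun g x y h => by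
    simp only [hV h, h m (Set.mem_Iic.2 le_rfl)]
  refine integral_mono
    ((hdep fun v y => ∑ s, (M.P y.1 y.2 s).toReal * (P ^ (t + l)).mulVec (fun s =>
      (v - M.valueFunction π) s * (P ^ i).mulVec (M.γ • P.mulVec (v - M.valueFunction π) -
        (v - M.valueFunction π)) s) s).integrable_of_finite _)
    ((hdep fun v _ => ∑ s, κ s * ((v - M.valueFunction π) s *
        (P ^ i).mulVec (M.γ • P.mulVec (v - M.valueFunction π) - (v - M.valueFunction π)) s) +
        2 * δ * (‖v - M.valueFunction π‖ * (2 * ‖v - M.valueFunction π‖))).integrable_of_finite _)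
    fun x => ?_
  set X := V x - M.valueFunction π with hX
  -- Given the history up to time `m`, `S_{m+1}` has law `P(S_m, A_m)`; the `t` mixing steps start
  -- there. The test function is bounded by `‖X‖ * (2 * ‖X‖)`.
  refine sum_mul_pow_mulVec_le_stationary hP ht (fun _ => ENNReal.toReal_nonneg)
    (PMF.sum_toReal_eq_one _) (fun s => ?_) (by positivity) l
  rw [hf, abs_mul]
  refine mul_le_mul (EuclideanSpace.abs_apply_le_norm X s)
    (abs_mulVec_le_of_mem_rowStochastic (pow_mem hP i) (fun s => ?_) s) (abs_nonneg _)
    (norm_nonneg _)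
  have h₂ := abs_le.1 (EuclideanSpace.abs_apply_le_norm X s)
  have h₃ : |M.γ * P.mulVec X s| ≤ ‖X‖ := by
    rw [abs_mul, abs_of_pos M.γ_pos]
    exact (mul_le_of_le_one_left (abs_nonneg _) M.γ_lt_one.le).trans
      (abs_mulVec_le_of_mem_rowStochastic hP (EuclideanSpace.abs_apply_le_norm X) s)
  have h₃ := abs_le.1 h₃
  change |M.γ * P.mulVec X s - X s| ≤ 2 * ‖X‖
  exact abs_le.2 ⟨by linarith, by linarith⟩

/-- The expected drift of TD(λ) with delayed iterate and truncated trace. -/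
lemma integral_drift_le [DecidableEq 𝒮] [Nonempty 𝒮] {κ : 𝒮 → ℝ}
    (hκ : IsStationaryDistribution (M.transitionMatrix π) κ) {δ lam : ℝ} {t : ℕ}
    (hδ : 0 ≤ δ) (hl0 : 0 < lam) (hl1 : lam < 1)
    (ht : ∀ s, tvDistance ((M.transitionMatrix π ^ t) s) κ ≤ δ) (ρ : PMF 𝒮) (m τ : ℕ)
    {V : (ℕ → 𝒮 × 𝒜) → EuclideanSpace ℝ 𝒮} (hV : DependsOn V (Set.Iic m)) :
    ∫ x, temporalDifference M (V x) (x (m + (t + τ + 1))).1 (x (m + (t + τ + 1))).2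
          (x (m + (t + τ + 1) + 1)).1 *
        inner ℝ (V x - M.valueFunction π) (truncatedTrace M.γ lam x (m + (t + τ + 1)) τ)
        ∂(M.trajectoryLaw π ρ) ≤
      (-(1 - tdContraction κ M.γ lam τ) + 4 * δ / (1 - M.γ * lam)) *
        ∫ x, ‖V x - M.valueFunction π‖ ^ 2 ∂(M.trajectoryLaw π ρ) := by
  set P := M.transitionMatrix π
  set k := m + (t + τ + 1) with hk
  have hP : P ∈ Matrix.rowStochastic ℝ 𝒮 := M.transitionMatrix_mem_rowStochastic π
  have hc0 : 0 ≤ M.γ * lam := mul_nonneg M.γ_pos.le hl0.le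
  have hc1 : M.γ * lam < 1 := by nlinarith [M.γ_pos, M.γ_lt_one]
  have hdep : ∀ (g : EuclideanSpace ℝ 𝒮 → ℝ), DependsOn (fun x => g (V x)) (Set.Iic m) :=
    fun g x y h => by simp only [hV h]
  let D : ℕ → EuclideanSpace ℝ 𝒮 → ℝ := fun i v => ∑ s, κ s * ((v - M.valueFunction π) s *
    (P ^ i).mulVec (M.γ • P.mulVec (v - M.valueFunction π) - (v - M.valueFunction π)) s)
  let R : EuclideanSpace ℝ 𝒮 → ℝ := fun v =>
    2 * δ * (‖v - M.valueFunction π‖ * (2 * ‖v - M.valueFunction π‖))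
  have hterm : ∀ i ∈ Finset.range (τ + 1),
      ∫ x, (M.γ * lam) ^ i * ((V x - M.valueFunction π) (x (k - i)).1 *
        temporalDifference M (V x) (x k).1 (x k).2 (x (k + 1)).1) ∂(M.trajectoryLaw π ρ) ≤
      ∫ x, (M.γ * lam) ^ i * (D i (V x) + R (V x)) ∂(M.trajectoryLaw π ρ) := by
    intro i hi
    rw [integral_const_mul, integral_const_mul]
    refine mul_le_mul_of_nonneg_left ?_ (pow_nonneg hc0 i)
    have hi : i ≤ τ := Nat.lt_succ_iff.1 (Finset.mem_range.1 hi)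
    -- Lag `i` leaves `t + (τ - i)` steps between `S_{m+1}` and `S_{k-i}`: never fewer than `t`,
    -- which is why the delay is `t + τ + 1`.
    have := integral_mul_temporalDifference_le (M := M) (π := π) ht ρ (m := m) i (τ - i) hV
    rwa [show m + 1 + (t + (τ - i)) + i = k by omega,
      show m + 1 + (t + (τ - i)) = k - i by omega] at this
  have hint₁ : ∀ i ∈ Finset.range (τ + 1), Integrable (fun x =>
      (M.γ * lam) ^ i * ((V x - M.valueFunction π) (x (k - i)).1 *
        temporalDifference M (V x) (x k).1 (x k).2 (x (k + 1)).1)) (M.trajectoryLaw π ρ) := by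
    intro i _
    refine DependsOn.integrable_of_finite (n := k + 1) (fun x y h => ?_) _
    have h₁ : V x = V y := hV fun j hj => h j (Set.mem_Iic.2 (by
      have : j ≤ m := hj
      omega))
    have h₂ : x (k - i) = y (k - i) := h _ (Set.mem_Iic.2 (by omega))
    have h₃ : x k = y k := h _ (Set.mem_Iic.2 (by omega))
    have h₄ : x (k + 1) = y (k + 1) := h _ (Set.mem_Iic.2 le_rfl)
    simp only [h₁, h₂, h₃, h₄]
  have hint₂ : ∀ i ∈ Finset.range (τ + 1), Integrable (fun x =>
      (M.γ * lam) ^ i * (D i (V x) + R (V x))) (M.trajectoryLaw π ρ) := fun i _ =>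
    (hdep fun v => (M.γ * lam) ^ i * (D i v + R v)).integrable_of_finite _
  have hpath : ∀ v : EuclideanSpace ℝ 𝒮,
      ∑ i ∈ Finset.range (τ + 1), (M.γ * lam) ^ i * (D i v + R v) ≤
      (-(1 - tdContraction κ M.γ lam τ) + 4 * δ / (1 - M.γ * lam)) *
        ‖v - M.valueFunction π‖ ^ 2 := by
    intro v
    simp only [mul_add, Finset.sum_add_distrib, ← Finset.sum_mul]
    have h₁ := hκ.td_drift_le hP M.γ_pos M.γ_lt_one hl0 hl1 (v - M.valueFunction π) τ
    have h₂ : ∑ i ∈ Finset.range (τ + 1), (M.γ * lam) ^ i ≤ 1 / (1 - M.γ * lam) := by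
      rw [one_div, ← tsum_geometric_of_lt_one hc0 hc1]
      exact (summable_geometric_of_lt_one hc0 hc1).sum_le_tsum _ fun i _ => pow_nonneg hc0 i
    have h₃ := mul_le_mul_of_nonneg_right h₂ (show 0 ≤ R v by positivity)
    have h₄ : 1 / (1 - M.γ * lam) * R v =
        4 * δ / (1 - M.γ * lam) * ‖v - M.valueFunction π‖ ^ 2 := by
      simp only [R]; ring
    have h₅ : ∑ s, (v.ofLp - (M.valueFunction π).ofLp) s ^ 2 = ‖v - M.valueFunction π‖ ^ 2 :=
      (EuclideanSpace.real_norm_sq_eq (v - M.valueFunction π)).symm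
    rw [h₄] at h₃
    rw [h₅] at h₁
    rw [add_mul]
    exact add_le_add h₁ h₃
  calc ∫ x, temporalDifference M (V x) (x k).1 (x k).2 (x (k + 1)).1 *
        inner ℝ (V x - M.valueFunction π) (truncatedTrace M.γ lam x k τ) ∂(M.trajectoryLaw π ρ)
      = ∫ x, ∑ i ∈ Finset.range (τ + 1), (M.γ * lam) ^ i *
          ((V x - M.valueFunction π) (x (k - i)).1 *
            temporalDifference M (V x) (x k).1 (x k).2 (x (k + 1)).1)
          ∂(M.trajectoryLaw π ρ) := by
        congr 1 with x
        rw [inner_truncatedTrace, Finset.mul_sum]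
        exact Finset.sum_congr rfl fun _ _ => by ring
    _ ≤ ∫ x, ∑ i ∈ Finset.range (τ + 1), (M.γ * lam) ^ i * (D i (V x) + R (V x))
          ∂(M.trajectoryLaw π ρ) := by
        rw [integral_finsetSum _ hint₁, integral_finsetSum _ hint₂]
        exact Finset.sum_le_sum hterm
    _ ≤ ∫ x, (-(1 - tdContraction κ M.γ lam τ) + 4 * δ / (1 - M.γ * lam)) *
          ‖V x - M.valueFunction π‖ ^ 2 ∂(M.trajectoryLaw π ρ) :=
        integral_mono (integrable_finsetSum _ hint₂)
          ((hdep fun v => (-(1 - tdContraction κ M.γ lam τ) + 4 * δ / (1 - M.γ * lam)) *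
            ‖v - M.valueFunction π‖ ^ 2).integrable_of_finite _) fun x => hpath (V x)
    _ = _ := integral_const_mul _ _

end DiscountedMDP

/-! ### The recursion for the mean square error. -/

/-- Absorption of the error terms of the one-step recursion into the negative drift `-2 α g X'`. -/
lemma drift_recursion {α ε h g b X X' Y D : ℝ} (hα : 0 < α) (hh0 : 0 < h) (hh1 : h ≤ 1)
    (hg0 : 0 < g) (hg1 : g ≤ 1) (hε0 : 0 < ε) (hε1 : ε ≤ 1 / 200) (hαε : α ≤ ε)
    (hεh : ε / h ≤ 1 / 200 * g) (hX' : 0 ≤ X')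
    (hY : Y ≤ X + 2 * α * D + α * ε / h * (17 * b ^ 2 + 73 * X'))
    (hD : D ≤ (-g + 4 * α / h) * X') (hX : X ≤ 7 / 5 * X' + 20 * (ε ^ 2 * b ^ 2)) :
    Y ≤ (1 - g * α) * X + 114 * b ^ 2 * (α * ε / h) := by
  set q := α * ε / h with hq
  have hq0 : 0 ≤ q := by positivity
  have hqg : q ≤ α * (1 / 200 * g) := by
    rw [hq, mul_div_assoc]; exact mul_le_mul_of_nonneg_left hεh hα.le
  have e₁ : 2 * α * D ≤ 2 * α * ((-g + 4 * α / h) * X') :=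
    mul_le_mul_of_nonneg_left hD (by positivity)
  have e₂ : α * (4 * α / h) ≤ 4 * q := by
    have : α * (4 * α / h) = 4 * (α * α / h) := by ring
    rw [this, hq]
    gcongr
  have e₃ : α * g * (20 * (ε ^ 2 * b ^ 2)) ≤ q * b ^ 2 := by
    have h₁ : α * g * (20 * (ε ^ 2 * b ^ 2)) = α * ε * b ^ 2 * (20 * (g * ε)) := by ring
    have h₂ : q * b ^ 2 = α * ε * b ^ 2 * (1 / h) := by rw [hq]; ring
    rw [h₁, h₂]
    refine mul_le_mul_of_nonneg_left ?_ (by positivity)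
    have : 1 ≤ 1 / h := by rw [le_div_iff₀ hh0]; linarith
    have : g * ε ≤ 1 * ε := mul_le_mul_of_nonneg_right hg1 hε0.le
    linarith
  have e₄ : α * (4 * α / h) * X' ≤ 4 * q * X' := mul_le_mul_of_nonneg_right e₂ hX'
  have e₅ : q * X' ≤ α * (1 / 200 * g) * X' := mul_le_mul_of_nonneg_right hqg hX'
  have e₆ : α * g * X ≤ α * g * (7 / 5 * X' + 20 * (ε ^ 2 * b ^ 2)) :=
    mul_le_mul_of_nonneg_left hX (by positivity)
  have e₇ : 0 ≤ q * b ^ 2 := by positivity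
  have e₈ : 0 ≤ α * g * X' := by positivity
  -- In units of `α g X'`: of the drift `-2`, the rate term uses at most `7 / 5`, and the errors
  -- `(73 + 8) q X'` at most `81 / 200 < 3 / 5`. The terms in `b²` sum to at most `18 q b²`, within
  -- `114`.
  linarith

namespace DiscountedMDP

variable {𝒮 𝒜 : Type*} [Fintype 𝒮] [MeasurableSpace 𝒮] [DiscreteMeasurableSpace 𝒮]
  [Fintype 𝒜] [MeasurableSpace 𝒜] [DiscreteMeasurableSpace 𝒜]
  {M : DiscountedMDP 𝒮 𝒜} {π : Policy 𝒮 𝒜}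

/-- The one-step recursion for the mean square error of TD(λ). -/
lemma integral_norm_sq_succ_le [DecidableEq 𝒮] [Nonempty 𝒮] {κ : 𝒮 → ℝ}
    (hκ : IsStationaryDistribution (M.transitionMatrix π) κ) {lam α : ℝ} {t τ : ℕ}
    (hα : 0 < α) (hl0 : 0 < lam) (hl1 : lam < 1)
    (ht : ∀ s, tvDistance ((M.transitionMatrix π ^ t) s) κ ≤ α)
    (hτ : (M.γ * lam) ^ (τ + 1) ≤ α)
    (hstep : α * (t + τ + 1) ≤ 1 / 200 * (1 - tdContraction κ M.γ lam τ) * (1 - M.γ * lam) ^ 2)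
    (ρ : PMF 𝒮) (V₀ : EuclideanSpace ℝ 𝒮) (m : ℕ) :
    ∫ x, ‖tdLambda M lam (fun _ => α) V₀ x (m + (t + τ + 1) + 1) - M.valueFunction π‖ ^ 2
        ∂(M.trajectoryLaw π ρ) ≤
      (1 - (1 - tdContraction κ M.γ lam τ) * α) *
        ∫ x, ‖tdLambda M lam (fun _ => α) V₀ x (m + (t + τ + 1)) - M.valueFunction π‖ ^ 2
          ∂(M.trajectoryLaw π ρ) +
      114 * (4 * ‖M.valueFunction π‖ + 1) ^ 2 *
        (α ^ 2 * (t + τ + 1) / (1 - M.γ * lam) ^ 2) := by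
  set Vπ := M.valueFunction π with hVπ
  set k := m + (t + τ + 1) with hk
  set h := 1 - M.γ * lam with hh
  set g := 1 - tdContraction κ M.γ lam τ with hg
  set b := 4 * ‖Vπ‖ + 1 with hb
  set μ := M.trajectoryLaw π ρ
  set V : ℕ → (ℕ → 𝒮 × 𝒜) → EuclideanSpace ℝ 𝒮 :=
    fun j x => tdLambda M lam (fun _ => α) V₀ x j with hV
  have hc0 : 0 ≤ M.γ * lam := mul_nonneg M.γ_pos.le hl0.le
  have hc1 : M.γ * lam < 1 := by nlinarith [M.γ_pos, M.γ_lt_one]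
  have hh0 : 0 < h := by linarith
  have hh1 : h ≤ 1 := by linarith
  have hg1 : g ≤ 1 := hκ.one_sub_tdContraction_le_one M.γ_pos M.γ_lt_one hl0 hl1 τ
  set N : ℝ := t + τ + 1 with hN
  have hN1 : 1 ≤ N := by
    have h₁ : (0 : ℝ) ≤ t := Nat.cast_nonneg t
    have h₂ : (0 : ℝ) ≤ τ := Nat.cast_nonneg τ
    linarith
  -- Positivity of `1 - β` is forced by the stepsize condition, whose left side is positive.
  have hg0 : 0 < g := by
    by_contra hneg
    have h₁ : 0 < α * N := by positivity
    have h₂ : g * h ^ 2 ≤ 0 := mul_nonpos_of_nonpos_of_nonneg (not_lt.1 hneg) (sq_nonneg h)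
    linarith
  set ε := N * (α / h) with hε
  have hεh : ε / h ≤ 1 / 200 * g := by
    rw [hε, ← mul_div_assoc, div_div, div_le_iff₀ (by positivity)]
    linarith
  have hε1 : ε ≤ 1 / 200 := by
    have h₁ : ε ≤ 1 / 200 * g * h := (div_le_iff₀ hh0).1 hεh
    nlinarith [mul_pos hg0 hh0, mul_le_mul hg1 hh1 hh0.le zero_le_one]
  have hαh0 : 0 < α / h := div_pos hα hh0
  have hαε : α / h ≤ ε := by
    rw [hε]; exact le_mul_of_one_le_left hαh0.le hN1
  have hε0 : 0 < ε := hαh0.trans_le hαε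
  have hααh : α ≤ α / h := by
    rw [le_div_iff₀ hh0]; exact mul_le_of_le_one_right hα.le hh1
  have hdepV : ∀ j, DependsOn (V j) (Set.Iic j) := fun j => dependsOn_tdLambda M lam V₀ _ j
  have hintV : ∀ j, Integrable (fun x => ‖V j x - Vπ‖ ^ 2) μ := fun j =>
    DependsOn.integrable_of_finite (n := j) (fun x y hxy => by simp only [hdepV j hxy]) μ
  let W : (ℕ → 𝒮 × 𝒜) → ℝ := fun x =>
    temporalDifference M (V m x) (x k).1 (x k).2 (x (k + 1)).1 *
      inner ℝ (V m x - Vπ) (truncatedTrace M.γ lam x k τ)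
  have hintW : Integrable W μ := by
    refine DependsOn.integrable_of_finite (n := k + 1) (fun x y hxy => ?_) μ
    have h₁ : V m x = V m y := hdepV m fun j hj => hxy j (Set.mem_Iic.2 (by
      have : j ≤ m := hj
      omega))
    have h₂ : truncatedTrace M.γ lam x k τ = truncatedTrace M.γ lam y k τ :=
      Finset.sum_congr rfl fun i _ => by rw [hxy (k - i) (Set.mem_Iic.2 (by omega))]
    simp only [W, h₁, h₂, hxy k (Set.mem_Iic.2 (Nat.le_succ k)),
      hxy (k + 1) (Set.mem_Iic.2 le_rfl)]
  have hB : ∀ x, 1 + 2 * ‖V m x‖ ≤ b + 2 * ‖V m x - Vπ‖ := fun x => by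
    have h₁ : ‖V m x‖ ≤ ‖V m x - Vπ‖ + ‖Vπ‖ := by
      have := norm_add_le (V m x - Vπ) Vπ
      rwa [sub_add_cancel] at this
    linarith [norm_nonneg Vπ]
  have hmove : ∀ x, ‖(V k x - Vπ) - (V m x - Vπ)‖ ≤ 2 * ε * (1 + 2 * ‖V m x‖) := fun x => by
    rw [sub_sub_sub_cancel_right]
    have hcast : ((t + τ + 1 : ℕ) : ℝ) = N := by push_cast; rfl
    have := norm_tdLambda_sub_le M lam α V₀ hα.le hc0 hc1 x m (t + τ + 1)
      (by rw [hcast]; change ε ≤ 1 / 4; linarith)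
    rwa [hcast] at this
  have hpath : ∀ x, ‖V (k + 1) x - Vπ‖ ^ 2 ≤ ‖V k x - Vπ‖ ^ 2 + 2 * α * W x +
      α * ε / h * (17 * b ^ 2 + 73 * ‖V m x - Vπ‖ ^ 2) := fun x => by
    have hstep : V (k + 1) x - Vπ = (V k x - Vπ) + (α * temporalDifference M (V k x) (x k).1
        (x k).2 (x (k + 1)).1) • truncatedTrace M.γ lam x k k := by
      rw [hV]
      simp only [tdLambda_succ M lam α V₀ x k]
      exact add_sub_right_comm _ _ _
    rw [hstep]
    refine norm_sq_add_smul_le' hα.le hh0 hh1 (by positivity) hαε (by linarith)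
      (norm_truncatedTrace_le hc0 hc1 x k k)
      ((norm_truncatedTrace_sub_le hc0 hc1 x (by omega)).trans ?_) (hmove x)
      (abs_temporalDifference_le M (V m x) _ _ _) ?_ (hB x)
    · exact div_le_div_of_nonneg_right hτ hh0.le
    · rw [sub_sub_sub_cancel_right]
      exact abs_temporalDifference_sub_le M _ _ _ _ _
  have hdrift : ∫ x, W x ∂μ ≤ (-g + 4 * α / h) * ∫ x, ‖V m x - Vπ‖ ^ 2 ∂μ :=
    integral_drift_le hκ hα.le hl0 hl1 ht ρ m τ (hdepV m)
  set Xm := ∫ x, ‖V m x - Vπ‖ ^ 2 ∂μ with hXm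
  have hXm0 : 0 ≤ Xm := integral_nonneg fun x => by positivity
  have h₁ : ∫ x, ‖V (k + 1) x - Vπ‖ ^ 2 ∂μ ≤ ∫ x, ‖V k x - Vπ‖ ^ 2 ∂μ + 2 * α * ∫ x, W x ∂μ +
      α * ε / h * (17 * b ^ 2 + 73 * Xm) := by
    have hi₁ : Integrable (fun x => 2 * α * W x) μ := hintW.const_mul _
    have hi₂ : Integrable (fun x => 73 * ‖V m x - Vπ‖ ^ 2) μ := (hintV m).const_mul _
    have hi₃ : Integrable (fun x => 17 * b ^ 2 + 73 * ‖V m x - Vπ‖ ^ 2) μ :=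
      (integrable_const _).add hi₂
    have hi₄ : Integrable (fun x => α * ε / h * (17 * b ^ 2 + 73 * ‖V m x - Vπ‖ ^ 2)) μ :=
      hi₃.const_mul _
    have hi₅ : Integrable (fun x => ‖V k x - Vπ‖ ^ 2 + 2 * α * W x) μ := (hintV k).add hi₁
    refine (integral_mono (hintV (k + 1)) (hi₅.add hi₄) hpath).trans_eq ?_
    rw [integral_add' hi₅ hi₄, integral_add (hintV k) hi₁, integral_const_mul,
      integral_const_mul, integral_add (integrable_const _) hi₂, integral_const, probReal_univ,
      one_smul, integral_const_mul]
  have h₂ : ∫ x, ‖V k x - Vπ‖ ^ 2 ∂μ ≤ 7 / 5 * Xm + 20 * (ε ^ 2 * b ^ 2) := by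
    have hi₂ : Integrable (fun x => 7 / 5 * ‖V m x - Vπ‖ ^ 2) μ := (hintV m).const_mul _
    refine (integral_mono (hintV k) (hi₂.add (integrable_const (20 * (ε ^ 2 * b ^ 2))))
      fun x => norm_sq_le_of_norm_sub_le hε0.le (by linarith) (hmove x) (hB x)).trans_eq ?_
    rw [integral_add' hi₂ (integrable_const _), integral_const_mul, integral_const,
      probReal_univ, one_smul]
  have hN2 : α ^ 2 * N / h ^ 2 = α * ε / h := by rw [hε]; field_simp
  rw [hN2]
  exact drift_recursion hα hh0 hh1 hg0 hg1 hε0 hε1 (hααh.trans hαε) hεh hXm0 h₁ hdrift h₂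

end DiscountedMDP

/-! ### The main theorem. -/

theorem theorem3p4 :
    ∃ c₀ : ℝ, 0 < c₀ ∧
      ∀ (𝒮 : Type u) (𝒜 : Type v) [Fintype 𝒮] [DecidableEq 𝒮] [Nonempty 𝒮]
        [MeasurableSpace 𝒮] [DiscreteMeasurableSpace 𝒮]
        [Fintype 𝒜] [MeasurableSpace 𝒜] [DiscreteMeasurableSpace 𝒜]
        (M : DiscountedMDP 𝒮 𝒜) (π : Policy 𝒮 𝒜),
        (M.transitionMatrix π).IsIrreducible →
        IsAperiodicChain (M.transitionMatrix π) →
        (∃! κ : 𝒮 → ℝ, IsStationaryDistribution (M.transitionMatrix π) κ) ∧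
        ∀ κ : 𝒮 → ℝ, IsStationaryDistribution (M.transitionMatrix π) κ →
        ∀ (Ω : Type w) [MeasurableSpace Ω] (μ : Measure Ω) (S : ℕ → Ω → 𝒮) (A : ℕ → Ω → 𝒜)
          (ρ : PMF 𝒮),
          HasLaw (fun ω k => (S k ω, A k ω)) (M.trajectoryLaw π ρ) μ →
        ∀ (V₀ : EuclideanSpace ℝ 𝒮) (lam α : ℝ) (t τ : ℕ) (β : ℝ),
          0 < lam → lam < 1 → 0 < α →
          t = mixingTime (M.transitionMatrix π) κ α →
          τ = truncationLevel M.γ lam α →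
          β = tdContraction κ M.γ lam τ →
          α * (t + 2 * τ + 1) ≤ c₀ * (1 - β) * (1 - M.γ * lam) ^ 2 →
        ∀ k : ℕ, t + 2 * τ + 1 ≤ k →
          let V : Ω → EuclideanSpace ℝ 𝒮 :=
            fun ω => tdLambda M lam (fun _ => α) V₀ (fun j => (S j ω, A j ω)) k
          let Vπ : EuclideanSpace ℝ 𝒮 := M.valueFunction π
          Integrable (fun ω => ‖V ω - Vπ‖ ^ 2) μ ∧
          ∫ ω, ‖V ω - Vπ‖ ^ 2 ∂μ ≤
            (‖V₀ - Vπ‖ + ‖V₀‖ + 1) ^ 2 * (1 - (1 - β) * α) ^ (k - (t + 2 * τ + 1)) +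
            114 * (4 * ‖Vπ‖ + 1) ^ 2 *
              (α * (t + τ + 1) / ((1 - M.γ * lam) ^ 2 * (1 - β))) := by
  refine ⟨1 / 200, by norm_num, ?_⟩
  intro 𝒮 𝒜 _ _ _ _ _ _ _ _ M π hirr hap
  have hP := M.transitionMatrix_mem_rowStochastic π
  refine ⟨existsUnique_isStationaryDistribution hP hirr hap, ?_⟩
  intro κ hκ Ω _ μ S A ρ hlaw V₀ lam α t τ β hl0 hl1 hα ht hτ hβ hstep k hk V Vπ
  have hc0 : 0 ≤ M.γ * lam := mul_nonneg M.γ_pos.le hl0.le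
  have hc1 : M.γ * lam < 1 := by nlinarith [M.γ_pos, M.γ_lt_one]
  have htv : ∀ s, tvDistance ((M.transitionMatrix π ^ t) s) κ ≤ α := fun s => by
    rw [ht]; exact tvDistance_mixingTime_le hP hirr hap hκ hα s
  have hpow : (M.γ * lam) ^ (τ + 1) ≤ α := by
    have hne : {j : ℕ | (M.γ * lam) ^ (j + 1) ≤ α}.Nonempty := by
      obtain ⟨j, hj⟩ := exists_pow_lt_of_lt_one hα hc1
      exact ⟨j, (pow_le_pow_of_le_one hc0 hc1.le (Nat.le_succ j)).trans hj.le⟩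
    rw [hτ]
    exact Nat.sInf_mem hne
  have ht0 : (0 : ℝ) ≤ t := Nat.cast_nonneg t
  have hτ0 : (0 : ℝ) ≤ τ := Nat.cast_nonneg τ
  have hh0 : 0 < 1 - M.γ * lam := by linarith
  have hβ1 : 1 - β ≤ 1 := by
    rw [hβ]; exact hκ.one_sub_tdContraction_le_one M.γ_pos M.γ_lt_one hl0 hl1 τ
  have hβ0 : 0 < 1 - β := by
    by_contra hneg
    have h₁ : 0 < α * (t + 2 * τ + 1) := by positivity
    have h₂ : (1 - β) * (1 - M.γ * lam) ^ 2 ≤ 0 :=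
      mul_nonpos_of_nonpos_of_nonneg (not_lt.1 hneg) (sq_nonneg _)
    linarith
  set E : ℕ → ℝ := fun j =>
    ∫ x, ‖tdLambda M lam (fun _ => α) V₀ x j - Vπ‖ ^ 2 ∂(M.trajectoryLaw π ρ) with hE
  have hdep : ∀ j, DependsOn (fun x : ℕ → 𝒮 × 𝒜 =>
      ‖tdLambda M lam (fun _ => α) V₀ x j - Vπ‖ ^ 2) (Set.Iic j) := fun j x y hxy => by
    simp only [dependsOn_tdLambda M lam V₀ _ j hxy]
  have hintegrable : ∀ j, Integrable (fun x : ℕ → 𝒮 × 𝒜 =>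
      ‖tdLambda M lam (fun _ => α) V₀ x j - Vπ‖ ^ 2) (M.trajectoryLaw π ρ) := fun j =>
    (hdep j).integrable_of_finite _
  have hrate : ∀ j, t + 2 * τ + 1 ≤ j → E (j + 1) ≤ (1 - (1 - β) * α) * E j +
      114 * (4 * ‖Vπ‖ + 1) ^ 2 * (α ^ 2 * (t + τ + 1) / (1 - M.γ * lam) ^ 2) := by
    intro j hj
    -- The recursion only needs `j ≥ t + τ + 1` and the stepsize bound with `τ` for `2τ`; both are
    -- weaker than what is assumed.
    have := DiscountedMDP.integral_norm_sq_succ_le hκ hα hl0 hl1 htv hpow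
      (by rw [← hβ]; nlinarith) ρ V₀ (j - (t + τ + 1))
    rwa [Nat.sub_add_cancel (by omega), ← hβ] at this
  have hα1 : α * (t + 2 * τ + 1) ≤ 1 / 200 * (1 - M.γ * lam) := by
    refine hstep.trans ?_
    have h₁ : (1 - M.γ * lam) ^ 2 ≤ 1 - M.γ * lam := by nlinarith
    have h₂ : (1 - β) * (1 - M.γ * lam) ^ 2 ≤ 1 * (1 - M.γ * lam) :=
      mul_le_mul hβ1 h₁ (by positivity) zero_le_one
    linarith
  have hr0 : 0 ≤ 1 - (1 - β) * α := by nlinarith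
  have hinit : E (t + 2 * τ + 1) ≤ (‖V₀ - Vπ‖ + ‖V₀‖ + 1) ^ 2 := by
    have hpath : ∀ x : ℕ → 𝒮 × 𝒜, ‖tdLambda M lam (fun _ => α) V₀ x (t + 2 * τ + 1) - Vπ‖ ^ 2 ≤
        (‖V₀ - Vπ‖ + ‖V₀‖ + 1) ^ 2 := by
      intro x
      have hη : ((t + 2 * τ + 1 : ℕ) : ℝ) * (α / (1 - M.γ * lam)) ≤ 1 / 200 := by
        rw [← mul_div_assoc, div_le_iff₀ hh0]
        push_cast
        linarith
      have h₁ := norm_tdLambda_sub_le M lam α V₀ hα.le hc0 hc1 x 0 (t + 2 * τ + 1)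
        (by linarith)
      rw [zero_add, show tdLambda M lam (fun _ => α) V₀ x 0 = V₀ from rfl] at h₁
      have h₂ := norm_sub_le_norm_sub_add_norm_sub
        (tdLambda M lam (fun _ => α) V₀ x (t + 2 * τ + 1)) V₀ Vπ
      have h₃ := norm_nonneg V₀
      -- With step mass at most `1 / 200`, the iterate has moved by at most `(1 + 2‖V₀‖) / 100`,
      -- well under `‖V₀‖ + 1`.
      have h₄ : 2 * (((t + 2 * τ + 1 : ℕ) : ℝ) * (α / (1 - M.γ * lam))) * (1 + 2 * ‖V₀‖) ≤
          ‖V₀‖ + 1 := by nlinarith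
      refine pow_le_pow_left₀ (norm_nonneg _) ?_ 2
      linarith
    refine (integral_mono (hintegrable _) (integrable_const _) hpath).trans_eq ?_
    simp
  have hmain : ∀ j, E (t + 2 * τ + 1 + j) ≤
      (‖V₀ - Vπ‖ + ‖V₀‖ + 1) ^ 2 * (1 - (1 - β) * α) ^ j + 114 * (4 * ‖Vπ‖ + 1) ^ 2 *
        (α * (t + τ + 1) / ((1 - M.γ * lam) ^ 2 * (1 - β))) := by
    intro j
    induction j with
    | zero =>
      rw [add_zero, pow_zero, mul_one]
      have : 0 ≤ 114 * (4 * ‖Vπ‖ + 1) ^ 2 *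
        (α * (t + τ + 1) / ((1 - M.γ * lam) ^ 2 * (1 - β))) := by positivity
      linarith
    | succ j ih =>
      have h₁ := hrate (t + 2 * τ + 1 + j) (by omega)
      have h₂ := mul_le_mul_of_nonneg_left ih hr0
      -- The claimed error floor is the fixed point of the affine recursion, so the inhomogeneous
      -- term is `(1 - β) α` times it.
      have h₃ : 114 * (4 * ‖Vπ‖ + 1) ^ 2 * (α ^ 2 * (t + τ + 1) / (1 - M.γ * lam) ^ 2) =
          (1 - β) * α * (114 * (4 * ‖Vπ‖ + 1) ^ 2 *
            (α * (t + τ + 1) / ((1 - M.γ * lam) ^ 2 * (1 - β)))) := by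
        field_simp
      rw [h₃] at h₁
      rw [pow_succ (1 - (1 - β) * α) j, ← add_assoc]
      linarith
  -- Both claims are transferred from the canonical path space to `Ω` through the law of the
  -- trajectory.
  have hae : AEStronglyMeasurable (fun x : ℕ → 𝒮 × 𝒜 =>
      ‖tdLambda M lam (fun _ => α) V₀ x k - Vπ‖ ^ 2) (μ.map fun ω j => (S j ω, A j ω)) :=
    (hdep k).measurable_of_finite.aestronglyMeasurable
  constructor
  · have := hintegrable k
    rw [← hlaw.map_eq, integrable_map_measure hae hlaw.aemeasurable] at this
    exact this
  · have hEk : ∫ ω, ‖V ω - Vπ‖ ^ 2 ∂μ = E k := by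
      rw [hE]
      simp only
      rw [← hlaw.map_eq, integral_map hlaw.aemeasurable hae]
    rw [hEk]
    have := hmain (k - (t + 2 * τ + 1))
    rwa [Nat.add_sub_cancel' hk] at this
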